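/- For a prime $p$ and $A,B,C,D\in\mathbb{F}_p$ let $$\mathcal{S}_{A,B,C,D}(\mathbb{F}_p)=\{(x,y,z)\in\mathbb{F}_p^3 : x^2+y^2+z^2=xyz+Ax+By+Cz+D\}.$$ The Vieta involutions $V_1(x,y,z)=(A+yz-x,y,z)$, $V_2(x,y,z)=(x,B+xz-y,z)$, $V_3(x,y,z)=(x,y,C+xy-z)$ act on this set; put $\Gamma=\langle V_1,V_2,V_3\rangle$. Let $\tau_{xy}$ exchange $x$ and $y$, let $\mathrm{neg}_{xy}$ negate $x$ and $y$, and similarly for the pairs $xz$, $yz$. Let $\Gamma'$ be the group generated by $\Gamma$ together with: $\mathrm{neg}_{xy}$ if $A=B=0$, $\tau_{xy}$ if $A=B$, $\mathrm{neg}_{xy}\circ\tau_{xy}$ if $A=-B$, and likewise for the pairs $(x,z)$ with $(A,C)$ and $(y,z)$ with $(B,C)$. Two quadruples of parameters are equivalent if one is obtained from the other by permuting $A,B,C$ and negating none or two of them; the same permutation and signs applied to the coordinates give a bijection of the corresponding surfaces that carries $\Gamma$-orbits to $\Gamma$-orbits. Let $E_{A,B,C,D}(p)\subseteq\mathcal{S}_{A,B,C,D}(\mathbb{F}_p)$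 be the union of the small orbits, namely all $\Gamma$-orbits which are carried by an equivalence to one of the following: * (Type I) a point fixed by $V_1$, $V_2$ and $V_3$; * (Type II) $\{(r,0,0),(s,0,0)\}$ for parameters $(a,0,0,d)$, where $r\ne s$ are roots in $\mathbb{F}_p$ of $X^2-aX-d$; * (Type III) $\{(-1,0,0),(-1,k,0),(-1,0,k)\}$ for parameters $(-2,k,k,-1)$; * (Type IV) $\{(-1,-1,-1),(k+2,-1,-1),(-1,k+2,-1),(-1,-1,k+2)\}$ for parameters $(k,k,k,4+3k)$; * (exceptional) the reduction of an exceptional finite orbit, i.e. the image, under a ring homomorphism to $\mathbb{F}_p$ from a ring of real numbers containing the parameters and the coordinates of the points, of one of the finite $\Gamma$-orbits with more than four points on the complex surfaces $\mathcal{S}_{a,b,c,d}$, $(a,b,c,d)\neq(0,0,0,4)$. By the classification of Lisovyy and Tykhyy there are, up to equivalence, exactly 45 of these; their parameters and coordinates are real algebraic integers, and representatives are taken from an explicit list. Put $\mathcal{S}^*_{A,B,C,D}(p)=\mathcal{S}_{A,B,C,D}(\mathbb{F}_p)\setminus E_{A,B,C,D}(p)$. **Theorem.** There is an absolute constant $N$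 such that for every prime $p\ge N$ and all $A,B,C,D\in\mathbb{F}_p$: if $\Gamma'$ acts transitively on $\mathcal{S}^*_{A,B,C,D}(p)$, then $\Gamma$ also acts transitively on $\mathcal{S}^*_{A,B,C,D}(p)$. -/

import Mathlib

namespace Markoff

/-- Parameters of the surface `X² + Y² + Z² = XYZ + AX + BY + CZ + D`:
`coef = (A, B, C)` and `D`. -/
structure Params (R : Type*) where
  coef : Fin 3 → R
  D : R

namespace Params

variable {R S : Type*}

abbrev A (P : Params R) : R := P.coef 0

abbrev B (P : Params R) : R := P.coef 1

abbrev C (P : Params R) : R := P.coef 2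

/-- Apply a map to all four parameters. -/
def map (f : R → S) (P : Params R) : Params S := ⟨fun i => f (P.coef i), f P.D⟩

end Params

section Surface

variable {R : Type*} [CommRing R]

/-- The `R`-points of the surface `S_{A,B,C,D}`, with `(x, y, z) = (v 0, v 1, v 2)`. -/
def surface (P : Params R) : Set (Fin 3 → R) :=
  {v | v 0 ^ 2 + v 1 ^ 2 + v 2 ^ 2
    = v 0 * v 1 * v 2 + P.A * v 0 + P.B * v 1 + P.C * v 2 + P.D}

/-- `(x, y, z) ↦ (A + yz - x, y, z)`. -/
def vietaFun1 (P : Params R) (v : Fin 3 → R) : Fin 3 → R :=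
  ![P.A + v 1 * v 2 - v 0, v 1, v 2]

/-- `(x, y, z) ↦ (x, B + xz - y, z)`. -/
def vietaFun2 (P : Params R) (v : Fin 3 → R) : Fin 3 → R :=
  ![v 0, P.B + v 0 * v 2 - v 1, v 2]

/-- `(x, y, z) ↦ (x, y, C + xy - z)`. -/
def vietaFun3 (P : Params R) (v : Fin 3 → R) : Fin 3 → R :=
  ![v 0, v 1, P.C + v 0 * v 1 - v 2]

theorem vietaFun1_involutive (P : Params R) : Function.Involutive (vietaFun1 P) := by
  intro v; funext i; fin_cases i <;> simp [vietaFun1]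

theorem vietaFun2_involutive (P : Params R) : Function.Involutive (vietaFun2 P) := by
  intro v; funext i; fin_cases i <;> simp [vietaFun2]

theorem vietaFun3_involutive (P : Params R) : Function.Involutive (vietaFun3 P) := by
  intro v; funext i; fin_cases i <;> simp [vietaFun3]

/-- The Vieta involution `V₁`, as a permutation of affine `3`-space that preserves `surface P`. -/
def V1 (P : Params R) : Equiv.Perm (Fin 3 → R) := (vietaFun1_involutive P).toPerm

/-- The Vieta involution `V₂`. -/
def V2 (P : Params R) : Equiv.Perm (Fin 3 → R) := (vietaFun2_involutive P).toPerm

/-- The Vieta involution `V₃`. -/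
def V3 (P : Params R) : Equiv.Perm (Fin 3 → R) := (vietaFun3_involutive P).toPerm

/-- `(x, y, z) ↦ (-x, -y, z)`. -/
def negXY : Equiv.Perm (Fin 3 → R) :=
  Function.Involutive.toPerm (fun v => ![-v 0, -v 1, v 2])
    (by intro v; funext i; fin_cases i <;> simp)

/-- `(x, y, z) ↦ (-x, y, -z)`. -/
def negXZ : Equiv.Perm (Fin 3 → R) :=
  Function.Involutive.toPerm (fun v => ![-v 0, v 1, -v 2])
    (by intro v; funext i; fin_cases i <;> simp)

/-- `(x, y, z) ↦ (x, -y, -z)`. -/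
def negYZ : Equiv.Perm (Fin 3 → R) :=
  Function.Involutive.toPerm (fun v => ![v 0, -v 1, -v 2])
    (by intro v; funext i; fin_cases i <;> simp)

/-- `(x, y, z) ↦ (y, x, z)`. -/
def tauXY : Equiv.Perm (Fin 3 → R) :=
  Function.Involutive.toPerm (fun v => ![v 1, v 0, v 2])
    (by intro v; funext i; fin_cases i <;> simp)

/-- `(x, y, z) ↦ (z, y, x)`. -/
def tauXZ : Equiv.Perm (Fin 3 → R) :=
  Function.Involutive.toPerm (fun v => ![v 2, v 1, v 0])
    (by intro v; funext i; fin_cases i <;> simp)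

/-- `(x, y, z) ↦ (x, z, y)`. -/
def tauYZ : Equiv.Perm (Fin 3 → R) :=
  Function.Involutive.toPerm (fun v => ![v 0, v 2, v 1])
    (by intro v; funext i; fin_cases i <;> simp)

/-- The group `Γ` generated by the three Vieta involutions. -/
def vietaGroup (P : Params R) : Subgroup (Equiv.Perm (Fin 3 → R)) :=
  Subgroup.closure {V1 P, V2 P, V3 P}

/-- The sign changes, transpositions and negated transpositions that are applicable to the
parameters `P`. -/
inductive IsExtraAut (P : Params R) : Equiv.Perm (Fin 3 → R) → Prop
  | negXY (hA : P.A = 0) (hB : P.B = 0) : IsExtraAut P negXY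
  | negXZ (hA : P.A = 0) (hC : P.C = 0) : IsExtraAut P negXZ
  | negYZ (hB : P.B = 0) (hC : P.C = 0) : IsExtraAut P negYZ
  | tauXY (h : P.A = P.B) : IsExtraAut P tauXY
  | tauXZ (h : P.A = P.C) : IsExtraAut P tauXZ
  | tauYZ (h : P.B = P.C) : IsExtraAut P tauYZ
  | negTauXY (h : P.A = -P.B) : IsExtraAut P (Markoff.negXY * Markoff.tauXY)
  | negTauXZ (h : P.A = -P.C) : IsExtraAut P (Markoff.negXZ * Markoff.tauXZ)
  | negTauYZ (h : P.B = -P.C) : IsExtraAut P (Markoff.negYZ * Markoff.tauYZ)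

/-- The group `Γ'` generated by the Vieta involutions together with all applicable sign changes,
transpositions and negated transpositions. -/
def fullGroup (P : Params R) : Subgroup (Equiv.Perm (Fin 3 → R)) :=
  Subgroup.closure ({V1 P, V2 P, V3 P} ∪ {g | IsExtraAut P g})

end Surface

section Equivalence

variable {R : Type*} [CommRing R]

/-- Permute the coordinates of a vector by `σ` and change signs by `ε`. -/
def signedPerm (σ : Equiv.Perm (Fin 3)) (ε : Fin 3 → ℤˣ) (v : Fin 3 → R) : Fin 3 → R :=
  fun i => ((ε i : ℤ) : R) * v (σ i)

/-- The parameters obtained by permuting `A, B, C` by `σ` and changing their signs by `ε`.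
When `∏ i, ε i = 1`, i.e. when none or two of the signs change, `signedPerm σ ε` is an isomorphism
of the surface with parameters `P` onto the surface with parameters `P.signedPerm σ ε`. -/
def Params.signedPerm (σ : Equiv.Perm (Fin 3)) (ε : Fin 3 → ℤˣ) (P : Params R) : Params R :=
  ⟨Markoff.signedPerm σ ε P.coef, P.D⟩

end Equivalence

section Exceptional

/-- A quadruple of real parameters, `(A, B, C, D) = (-ωX, -ωY, -ωZ, d)`, together with the point
`(-2 cos π rX, -2 cos π rY, -2 cos π rZ)` of the corresponding surface. -/
noncomputable def mkSeed (ωX ωY ωZ d rX rY rZ : ℝ) : Params ℝ × (Fin 3 → ℝ) :=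
  (⟨![-ωX, -ωY, -ωZ], d⟩,
    ![-2 * Real.cos (Real.pi * rX), -2 * Real.cos (Real.pi * rY), -2 * Real.cos (Real.pi * rZ)])

/-- `2 cos (2 π k / 7)`. -/
noncomputable def c7 (k : ℝ) : ℝ := 2 * Real.cos (2 * Real.pi * k / 7)

/-- The 45 exceptional finite orbits in characteristic zero (the finite `Γ`-orbits with more than
four points on surfaces other than the Cayley cubic `(A, B, C, D) = (0, 0, 0, 4)`, up to
equivalence, as classified by Lisovyy and Tykhyy), each given by its parameters and one of its
points. -/
noncomputable def exceptionalSeeds : List (Params ℝ × (Fin 3 → ℝ)) :=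
  [
    -- orbits of size 5
    mkSeed 0 1 1 0 (1/2) (1/2) (1/2),
    mkSeed 3 2 2 (-3) (1/3) (1/3) (1/2),
    -- orbits of size 6
    mkSeed 1 0 0 2 (1/2) (1/3) (1/3),
    mkSeed √2 0 0 1 (1/2) (1/3) (1/2),
    mkSeed (1 - √5) ((3 - √5) / 2) ((3 - √5) / 2) (-2 + √5) (3/5) (1/3) (1/2),
    mkSeed 3 (2 * √2) (2 * √2) (-4) (1/3) (1/4) (1/2),
    mkSeed (1 + √5) ((3 + √5) / 2) ((3 + √5) / 2) (-2 - √5) (1/5) (1/3) (1/2),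
    -- orbits of size 7
    mkSeed 1 1 1 0 (1/2) (1/2) (1/2),
    -- orbits of size 8
    mkSeed ((3 - √5) / 2) 1 1 ((-1 + √5) / 2) (1/3) (1/2) (1/2),
    mkSeed 2 0 0 0 (1/3) (1/3) (1/2),
    mkSeed 1 √2 √2 0 (1/2) (1/2) (1/2),
    mkSeed ((3 + √5) / 2) 1 1 ((-1 - √5) / 2) (1/3) (1/2) (1/2),
    -- orbits of size 9
    mkSeed (2 - √5) (2 - √5) (2 - √5) ((-7 + 5 * √5) / 2) (1/3) (1/3) (3/5),
    mkSeed (2 + √5) (2 + √5) (2 + √5) ((-7 - 5 * √5) / 2) (1/5) (1/3) (1/3),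
    -- orbits of size 10
    mkSeed (3 - √5) (3 - √5) (3 - √5) ((-11 + 7 * √5) / 2) (1/3) (3/5) (3/5),
    mkSeed 1 0 0 1 (1/2) (1/3) (1/2),
    mkSeed ((1 + √5) / 2) ((1 + √5) / 2) ((1 + √5) / 2) 0 (1/2) (1/2) (1/2),
    mkSeed ((1 - √5) / 2) ((1 - √5) / 2) ((1 - √5) / 2) 0 (1/2) (1/2) (1/2),
    mkSeed (3 + √5) (3 + √5) (3 + √5) ((-11 - 7 * √5) / 2) (1/5) (1/5) (1/3),
    -- orbits of size 12
    mkSeed 0 0 0 3 (1/4) (1/3) (1/2),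
    mkSeed ((3 - √5) / 2) ((-1 + √5) / 2) ((-1 + √5) / 2) √5 (1/3) (1/2) (2/3),
    mkSeed 1 0 0 2 (1/2) (1/4) (1/2),
    mkSeed ((1 + √5) / 2) 1 ((-1 + √5) / 2) 0 (1/2) (1/2) (1/2),
    mkSeed 2 √5 √5 (-2) (1/3) (1/5) (1/2),
    mkSeed ((3 + √5) / 2) ((1 + √5) / 2) ((1 + √5) / 2) (-√5) (1/3) (1/3) (1/2),
    -- orbits of size 15
    mkSeed ((3 - √5) / 2) ((3 - √5) / 2) ((3 - √5) / 2) (-1 + √5) (1/3) (1/3) (1/2),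
    mkSeed ((5 - √5) / 2) (-1 + √5) (-1 + √5) ((-5 + 3 * √5) / 2) (1/3) (1/5) (2/3),
    mkSeed ((3 + √5) / 2) ((3 + √5) / 2) ((3 + √5) / 2) (-1 - √5) (1/3) (1/3) (1/2),
    mkSeed ((5 + √5) / 2) (1 + √5) (1 + √5) ((-5 - 3 * √5) / 2) (1/3) (1/5) (1/3),
    -- orbits of size 16
    mkSeed 0 0 0 2 (1/3) (1/3) (1/2),
    -- orbits of size 18
    mkSeed (1 - c7 1) (1 - c7 1) (1 - c7 1) (2 * c7 1) (1/3) (1/3) (1/2),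
    mkSeed (1 - c7 2) (1 - c7 2) (1 - c7 2) (2 * c7 2) (1/3) (1/3) (1/2),
    mkSeed 2 2 2 (-1) (1/5) (1/3) (1/3),
    mkSeed (1 - c7 3) (1 - c7 3) (1 - c7 3) (2 * c7 3) (1/3) (1/3) (1/2),
    -- orbits of size 20
    mkSeed ((3 - √5) / 2) 0 0 (1 + √5) (1/3) (1/5) (1/2),
    mkSeed 1 ((-1 + √5) / 2) ((-1 + √5) / 2) ((1 + √5) / 2) (1/2) (1/2) (2/3),
    mkSeed 1 ((1 + √5) / 2) ((1 + √5) / 2) ((1 - √5) / 2) (1/2) (1/3) (1/2),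
    mkSeed ((3 + √5) / 2) 0 0 (1 - √5) (1/3) (2/5) (1/2),
    -- orbits of size 24
    mkSeed 1 1 1 1 (1/5) (1/2) (1/2),
    -- orbits of size 30
    mkSeed ((-1 + √5) / 2) 0 0 ((3 + √5) / 2) (2/3) (1/3) (1/2),
    mkSeed ((1 + √5) / 2) 0 0 ((3 - √5) / 2) (1/3) (1/3) (1/2),
    -- orbits of size 36
    mkSeed 1 0 0 2 (1/5) (1/3) (1/2),
    -- orbits of size 40
    mkSeed 0 0 0 ((5 + √5) / 2) (1/5) (1/3) (1/2),
    mkSeed 0 0 0 ((5 - √5) / 2) (1/3) (2/5) (1/2),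
    -- orbits of size 72
    mkSeed 0 0 0 3 (1/5) (1/3) (2/3)]

/-- `(P, w)` is a reduction of `(P₀, w₀)`: the parameters `P` and the point `w` are the images of
the real parameters `P₀` and the real point `w₀` under a ring homomorphism that is defined on some
ring of real numbers containing all of these. -/
def IsReduction {F : Type*} [CommRing F] (P₀ : Params ℝ) (w₀ : Fin 3 → ℝ)
    (P : Params F) (w : Fin 3 → F) : Prop :=
  ∃ (R : Subring ℝ) (φ : R →+* F) (Q : Params R) (u : Fin 3 → R),
    Q.map R.subtype = P₀ ∧ (∀ i, (u i : ℝ) = w₀ i) ∧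
    Q.map φ = P ∧ ∀ i, φ (u i) = w i

end Exceptional

section SmallOrbits

variable {F : Type*} [CommRing F]

/-- `IsSmallSeed P w` says that `w` is the listed base point of a small `Γ`-orbit on the surface
with parameters `P`, in the normal form for `P`. -/
inductive IsSmallSeed : Params F → (Fin 3 → F) → Prop
  /-- the orbit `{w}`, where `w` is fixed by all three Vieta involutions -/
  | typeI (P : Params F) (w : Fin 3 → F) (hw : w ∈ surface P)
      (h1 : V1 P w = w) (h2 : V2 P w = w) (h3 : V3 P w = w) : IsSmallSeed P w
  /-- the orbit `{(r, 0, 0), (s, 0, 0)}`, where `r ≠ s` are the roots of `X² - aX - d` -/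
  | typeII (a d r s : F) (hrs : r ≠ s) (hr : r ^ 2 - a * r - d = 0) (hs : s ^ 2 - a * s - d = 0) :
      IsSmallSeed ⟨![a, 0, 0], d⟩ ![r, 0, 0]
  /-- the orbit `{(-1, 0, 0), (-1, k, 0), (-1, 0, k)}` -/
  | typeIII (k : F) : IsSmallSeed ⟨![-2, k, k], -1⟩ ![-1, 0, 0]
  /-- the orbit `{(-1, -1, -1), (k + 2, -1, -1), (-1, k + 2, -1), (-1, -1, k + 2)}` -/
  | typeIV (k : F) : IsSmallSeed ⟨![k, k, k], 4 + 3 * k⟩ ![-1, -1, -1]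
  /-- the reduction of an exceptional orbit -/
  | exceptional (s : Params ℝ × (Fin 3 → ℝ)) (hs : s ∈ exceptionalSeeds)
      (P : Params F) (w : Fin 3 → F) (h : IsReduction s.1 s.2 P w) : IsSmallSeed P w

/-- The union `E` of all small `Γ`-orbits: those points that some equivalence of parameters maps
into the `Γ`-orbit of a listed base point. -/
def smallOrbits (P : Params F) : Set (Fin 3 → F) :=
  {v | ∃ (σ : Equiv.Perm (Fin 3)) (ε : Fin 3 → ℤˣ), ∏ i, ε i = 1 ∧
    ∃ w, IsSmallSeed (P.signedPerm σ ε) w ∧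
      ∃ g ∈ vietaGroup (P.signedPerm σ ε), g w = signedPerm σ ε v}

/-- `S*`: the points of the surface outside all small orbits. -/
def surfaceStar (P : Params F) : Set (Fin 3 → F) := surface P \ smallOrbits P

/-- The group `G` of permutations acts transitively on the subset `s`. -/
def ActsTransitivelyOn {α : Type*} (G : Subgroup (Equiv.Perm α)) (s : Set α) : Prop :=
  ∀ u ∈ s, ∀ v ∈ s, ∃ g ∈ G, g u = v

end SmallOrbits

end Markoff

/-! Γ' arises from Γ by adjoining signed permutations that preserve the parameters, and these
normalise Γ. If Γ' is transitive on S*, then for a fixed w in S* every point of S* lies in the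
Γ-orbit of the image of w under one such automorphism. So it suffices to find one w that every
automorphism keeps in its own Γ-orbit (`IsStable`, `descends_of_exists_isStable`). If no extra
automorphism applies, Γ' = Γ; otherwise an equivalence achieves B = C.

For B = C the rotation τ_yz ∘ V₂ fixes x, acts on (y, z) by an affine map whose linear part is the
companion matrix of X² - xX + 1, and agrees with τ_yz up to Γ. If an odd iterate fixes v, then τ_yz
v lies in the Γ-orbit of v. This happens for x = 2, where the p-th iterate is trivial, and for x = ω
+ ω⁻¹ with ω of odd order, which is read off from the quadratic characters of x + 2 and x - 2
(`IsOddType`). If B = C = 0, iterates equal to -1 give sign changes as well.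

It remains to find points of S* with such coordinates. Coordinates of points in small orbits lie in
a set whose size is bounded independently of p (`exists_finset_smallOrbits`), and a pair (x, y)
extends to a point when a discriminant is a square. Thus elements with prescribed quadratic
characters at three points are needed (`exists_quadraticChar_eq`). No Weil bound is used: it is
enough that the character of a separable cubic is not nearly constant, which follows from a
Stepanov-type argument (`card_le_of_cubic_pow_eq_const`).

The cases are (A, B, C) = (c, a, a) with a ≠ 0 and c ≠ ±a, (a, a, a), (c, 0, 0) and (0, 0, 0). In
the last two, a sign change is realised at one point and carried to another by the transitivity of
Γ'. -/

namespace Markoff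

/-! ### Quadratic characters at three points -/

open Polynomial in
/-- A cubic with three distinct roots cannot have constant quadratic character off a small set. -/
theorem card_le_of_cubic_pow_eq_const {p : ℕ} [Fact p.Prime] {m : ℕ} (hp : p = 2 * m + 1)
    {a b c s : ZMod p} (hab : a ≠ b) (hac : a ≠ c) (hs : s ≠ 0) (T : Finset (ZMod p))
    (hT : ∀ y ∉ T, ((y - a) * (y - b) * (y - c)) ^ m = s) : m ≤ 2 * T.card + 1 := by
  by_contra! hlt
  set k := T.card with hk
  set f : (ZMod p)[X] := (X - C a) * (X - C b) * (X - C c) with hf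
  set h : (ZMod p)[X] := ∏ t ∈ T, (X - C t) with hh
  have hfdeg : f.natDegree = 3 := by
    rw [hf, natDegree_mul (mul_ne_zero (X_sub_C_ne_zero a) (X_sub_C_ne_zero b))
      (X_sub_C_ne_zero c), natDegree_mul (X_sub_C_ne_zero a) (X_sub_C_ne_zero b)]
    simp
  have hhdeg : h.natDegree = k := by
    rw [hh, natDegree_prod_of_monic _ _ (fun t _ => monic_X_sub_C t)]; simp [hk]
  have hh0 : h ≠ 0 := (monic_prod_of_monic _ _ (fun t _ => monic_X_sub_C t)).ne_zero
  have hp1 : 1 < p := (Fact.out : p.Prime).one_lt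
  have hdeg : (X ^ p - X : (ZMod p)[X]).natDegree = p :=
    FiniteField.X_pow_card_sub_X_natDegree_eq (ZMod p) hp1
  have hne : (X ^ p - X : (ZMod p)[X]) ≠ 0 := FiniteField.X_pow_card_sub_X_ne_zero (ZMod p) hp1
  have hzero : ∀ y : ZMod p, (f ^ m * h - C s * h).eval y = 0 := by
    intro y
    by_cases hy : y ∈ T
    · have : h.eval y = 0 := by
        rw [hh, eval_prod]; exact Finset.prod_eq_zero hy (by simp)
      simp [this]
    · have := hT y hy
      simp only [eval_sub, eval_mul, eval_pow, eval_C, hf, eval_X, this]; ring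
  have hdvd : (X ^ p - X : (ZMod p)[X]) ∣ f ^ m * h - C s * h := by
    have h1 : (X ^ p - X : (ZMod p)[X]) = ∏ y : ZMod p, (X - C y) := by
      have := FiniteField.X_pow_card_sub_X_natDegree_eq (ZMod p) hp1
      have hr := FiniteField.roots_X_pow_card_sub_X (ZMod p)
      rw [ZMod.card] at hr
      have := prod_multiset_X_sub_C_of_monic_of_roots_card_eq (p := (X ^ p - X : (ZMod p)[X]))
        (monic_X_pow_sub (by simpa using hp1)) (by rw [hr, hdeg]; simp [ZMod.card])
      rw [hr] at this
      exact this.symm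
    rw [h1]
    apply Finset.prod_dvd_of_coprime
    · intro x _ y _ hxy
      exact isCoprime_X_sub_C_of_isUnit_sub (sub_ne_zero.2 hxy).isUnit
    · intro y _
      exact dvd_iff_isRoot.2 (hzero y)
  obtain ⟨g, hg⟩ := hdvd
  have hgdeg : g.natDegree ≤ m + k - 1 := by
    by_cases hg0 : g = 0
    · simp [hg0]
    have h1 : (f ^ m * h - C s * h).natDegree = p + g.natDegree := by
      rw [hg, natDegree_mul hne hg0, hdeg]
    have h2 : (f ^ m * h - C s * h).natDegree ≤ 3 * m + k := by
      refine (natDegree_sub_le _ _).trans (max_le ?_ ?_)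
      · refine natDegree_mul_le.trans ?_
        have := natDegree_pow_le (p := f) (n := m)
        rw [hfdeg] at this; omega
      · exact (natDegree_C_mul_le _ _).trans (by omega)
    omega
  have hpX : (p : (ZMod p)[X]) = 0 := by
    rw [← C_eq_natCast]; simp
  have hmX : (2 * m + 1 : (ZMod p)[X]) = 0 := by
    have := congrArg (Nat.cast : ℕ → (ZMod p)[X]) hp
    push_cast at this
    rw [← this, hpX]
  have hder : derivative (f ^ m * h) =
      C s * derivative h - g + (X ^ p - X) * derivative g := by
    have : f ^ m * h = C s * h + (X ^ p - X) * g := by rw [← hg]; ring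
    rw [this]
    simp only [derivative_add, derivative_mul, derivative_C, derivative_sub, derivative_X_pow,
      derivative_X, map_natCast, hpX]
    ring
  -- Since 2m = -1 in characteristic p, the logarithmic derivative of `f ^ m` is -f'/(2f).
  have hder2 : 2 * f * derivative (f ^ m * h) =
      f ^ m * (2 * f * derivative h - derivative f * h) := by
    have hm : m ≠ 0 := by omega
    have hpow : f ^ m = f ^ (m - 1) * f := by rw [← pow_succ]; congr 1; omega
    simp only [derivative_mul, derivative_pow, map_natCast]
    rw [hpow]
    linear_combination (f ^ (m - 1) * f * derivative f * h) * hmX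
  -- Both expressions for the derivative are compared and `f ^ m * h` is replaced by `C s * h`
  -- modulo `X ^ p - X`. The left side has small degree, so it and the cofactor on the right must
  -- vanish.
  have key : C s * derivative f * h ^ 2 * (-1) + 2 * f * h * g = (X ^ p - X) *
      (2 * f * h * derivative g - (2 * f * derivative h - derivative f * h) * g) := by
    have h1 : f ^ m * h = C s * h + (X ^ p - X) * g := by rw [← hg]; ring
    linear_combination (-h) * hder2 + (2 * f * h) * hder -
      (2 * f * derivative h - derivative f * h) * h1
  have hdeg2 : (C s * derivative f * h ^ 2 * (-1) + 2 * f * h * g).natDegree < p := by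
    have e1 : (C s * derivative f * h ^ 2 * (-1)).natDegree ≤ 2 + 2 * k := by
      have : C s * derivative f * h ^ 2 * (-1) = C (-s) * (derivative f * h ^ 2) := by
        rw [C_neg]; ring
      rw [this]
      refine (natDegree_C_mul_le _ _).trans (natDegree_mul_le.trans ?_)
      have := natDegree_derivative_le f
      have := natDegree_pow_le (p := h) (n := 2)
      omega
    have e2 : (2 * f * h * g).natDegree ≤ 3 + k + (m + k - 1) := by
      have : 2 * f * h * g = C 2 * (f * h * g) := by
        simp only [C_ofNat]; ring
      rw [this]
      refine (natDegree_C_mul_le _ _).trans (natDegree_mul_le.trans ?_)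
      have := natDegree_mul_le (p := f) (q := h)
      omega
    refine lt_of_le_of_lt (natDegree_add_le _ _) (max_lt ?_ ?_) <;> omega
  have hQ : 2 * f * h * derivative g - (2 * f * derivative h - derivative f * h) * g = 0 := by
    by_contra hQ
    rw [key, natDegree_mul hne hQ, hdeg] at hdeg2
    omega
  rw [hQ, mul_zero] at key
  -- Eliminating `g` and `h` from this identity, its derivative and `hQ` leaves 2ff'' = f'², which
  -- fails at the simple root `a`.
  have h1 : 2 * f * g = C s * derivative f * h := by
    apply mul_left_cancel₀ hh0
    linear_combination key
  have h2 : 2 * derivative f * g + 2 * f * derivative g =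
      C s * derivative (derivative f) * h + C s * derivative f * derivative h := by
    have := congrArg derivative h1
    simp only [derivative_mul, derivative_C, derivative_ofNat] at this
    linear_combination this
  have h3 : C s * derivative (derivative f) * h = derivative f * g := by
    apply mul_left_cancel₀ hh0
    linear_combination (-h) * h2 + hQ + derivative h * h1
  have h4 : 2 * f * derivative (derivative f) = derivative f ^ 2 := by
    apply mul_left_cancel₀ hh0
    apply mul_left_cancel₀ (C_ne_zero.2 hs)
    linear_combination (2 * f) * h3 + derivative f * h1
  have h5 := congrArg (eval a) h4
  have hfa : f.eval a = 0 := by simp [hf]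
  have hfa' : (derivative f).eval a = (a - b) * (a - c) := by
    simp [hf, derivative_mul]
  simp only [eval_mul, eval_pow, hfa, hfa', mul_zero, zero_mul] at h5
  have := mul_ne_zero (sub_ne_zero.2 hab) (sub_ne_zero.2 hac)
  exact this (pow_eq_zero_iff two_ne_zero |>.1 h5.symm)

theorem sum_quadraticChar_sub {p : ℕ} [Fact p.Prime] (hp : p ≠ 2) (a : ZMod p) :
    ∑ y : ZMod p, quadraticChar (ZMod p) (y - a) = 0 := by
  rw [← quadraticChar_sum_zero (F := ZMod p) (by rwa [ZMod.ringChar_zmod_n])]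
  exact (Equiv.subRight a).sum_comp (fun y => quadraticChar (ZMod p) y)

/-- The affine substitution taking 0, 1 to a, b turns the sum into χ(-1) times the Jacobi sum J(χ,
χ) = -χ(-1). -/
theorem sum_quadraticChar_mul {p : ℕ} [Fact p.Prime] (hp : p ≠ 2) {a b : ZMod p} (hab : a ≠ b) :
    ∑ y : ZMod p, quadraticChar (ZMod p) (y - a) * quadraticChar (ZMod p) (y - b) = -1 := by
  have h2 : ringChar (ZMod p) ≠ 2 := by rwa [ZMod.ringChar_zmod_n]
  have hχ := quadraticChar_ne_one h2
  have hJ := jacobiSum_nontrivial_inv hχ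
  rw [(quadraticChar_isQuadratic (F := ZMod p)).inv] at hJ
  have hd : b - a ≠ 0 := sub_ne_zero.2 hab.symm
  unfold jacobiSum at hJ
  let e : ZMod p ≃ ZMod p :=
    { toFun := fun x => a + (b - a) * x
      invFun := fun y => (y - a) / (b - a)
      left_inv := fun x => by field_simp; ring
      right_inv := fun y => by field_simp; ring }
  rw [← e.sum_comp]
  have h1 : ∀ x : ZMod p, quadraticChar (ZMod p) (e x - a) * quadraticChar (ZMod p) (e x - b) =
      quadraticChar (ZMod p) (-1) *
        (quadraticChar (ZMod p) x * quadraticChar (ZMod p) (1 - x)) := by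
    intro x
    have : (e x - a) * (e x - b) = (b - a) ^ 2 * ((-1) * (x * (1 - x))) := by
      simp only [e, Equiv.coe_fn_mk]; ring
    rw [← map_mul, this, map_mul, quadraticChar_sq_one' hd, one_mul, map_mul, map_mul]
  rw [Finset.sum_congr rfl (fun x _ => h1 x), ← Finset.mul_sum, hJ]
  have := quadraticChar_sq_one (F := ZMod p) (a := -1) (by simp)
  linear_combination -this

/-- Prescribed quadratic characters at three linear forms, avoiding a small set. -/
theorem exists_quadraticChar_eq {p : ℕ} [Fact p.Prime] {K : ℕ} (hpK : 32 * K + 200 ≤ p)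
    (R : Finset (ZMod p)) (hR : R.card ≤ K) {a b c : ZMod p} (hab : a ≠ b) (hac : a ≠ c)
    (hbc : b ≠ c) {s t u : ℤ} (hs : s = 1 ∨ s = -1) (ht : t = 1 ∨ t = -1) (hu : u = 1 ∨ u = -1) :
    ∃ y ∉ R, quadraticChar (ZMod p) (y - a) = s ∧ quadraticChar (ZMod p) (y - b) = t ∧
      quadraticChar (ZMod p) (y - c) = u := by
  by_contra! hno
  have hp2 : p ≠ 2 := by omega
  have hring : ringChar (ZMod p) ≠ 2 := by rwa [ZMod.ringChar_zmod_n]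
  obtain ⟨m, hm⟩ := (Fact.out : p.Prime).odd_of_ne_two hp2
  set χ := quadraticChar (ZMod p) with hχ
  have hval : ∀ x : ZMod p, x ≠ 0 → χ x = 1 ∨ χ x = -1 := fun x hx => quadraticChar_dichotomy hx
  have hval' : ∀ x : ZMod p, χ x = 0 ∨ χ x = 1 ∨ χ x = -1 := fun x => by
    by_cases hx : x = 0
    · left; simp [hχ, hx]
    · right; exact hval x hx
  set w : ℤ := -(s * t * u) with hw
  have hw1 : w = 1 ∨ w = -1 := by
    rcases hs with rfl | rfl <;> rcases ht with rfl | rfl <;> rcases hu with rfl | rfl <;>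
      simp [hw]
  -- Away from a, b, c this is 8 at the wanted elements and 0 elsewhere. If there are none outside
  -- `R`, the sum of `g` is at most 8(K + 3).
  let g : ZMod p → ℤ := fun y => (1 + s * χ (y - a)) * (1 + t * χ (y - b)) * (1 + u * χ (y - c))
  set R' : Finset (ZMod p) := R ∪ {a, b, c} with hR'
  have hR'card : R'.card ≤ K + 3 := by
    refine (Finset.card_union_le _ _).trans ?_
    have := Finset.card_le_three (a := a) (b := b) (c := c)
    omega
  have hg : ∀ y ∉ R', g y = 0 := by
    intro y hy
    simp only [hR', Finset.mem_union, Finset.mem_insert, Finset.mem_singleton, not_or] at hy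
    obtain ⟨h0, h1, h2, h3⟩ := hy
    have hn := hno y h0
    have f1 := hval _ (sub_ne_zero.2 h1)
    have f2 := hval _ (sub_ne_zero.2 h2)
    have f3 := hval _ (sub_ne_zero.2 h3)
    simp only [g]
    rcases f1 with e1 | e1 <;> rcases f2 with e2 | e2 <;> rcases f3 with e3 | e3 <;>
      rcases hs with rfl | rfl <;> rcases ht with rfl | rfl <;> rcases hu with rfl | rfl <;>
      simp [e1, e2, e3] at hn ⊢
  have hgle : ∀ y, g y ≤ 8 := by
    intro y
    have b1 : ∀ (s : ℤ) (x : ZMod p), (s = 1 ∨ s = -1) → 0 ≤ 1 + s * χ x ∧ 1 + s * χ x ≤ 2 := by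
      intro s x hs
      rcases hs with rfl | rfl <;> rcases hval' x with h | h | h <;> simp [h]
    have := b1 s (y - a) hs
    have := b1 t (y - b) ht
    have := b1 u (y - c) hu
    simp only [g]
    calc _ ≤ 2 * 2 * (2 : ℤ) := by gcongr <;> tauto
      _ = 8 := by norm_num
  have hgsum : ∑ y, g y ≤ 8 * (K + 3) := by
    rw [← Finset.sum_subset (Finset.subset_univ R') (fun y _ hy => hg y hy)]
    refine (Finset.sum_le_card_nsmul _ _ 8 (fun y _ => hgle y)).trans ?_
    simp only [nsmul_eq_mul]
    have : (R'.card : ℤ) ≤ K + 3 := by exact_mod_cast hR'card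
    linarith
  have hexp : ∑ y, g y = p + (s * t * (-1) + s * u * (-1) + t * u * (-1)) +
      s * t * u * ∑ y, χ (y - a) * χ (y - b) * χ (y - c) := by
    have : ∀ y, g y = 1 + s * χ (y - a) + t * χ (y - b) + u * χ (y - c)
        + s * t * (χ (y - a) * χ (y - b)) + s * u * (χ (y - a) * χ (y - c))
        + t * u * (χ (y - b) * χ (y - c))
        + s * t * u * (χ (y - a) * χ (y - b) * χ (y - c)) := fun y => by simp only [g]; ring
    rw [Finset.sum_congr rfl (fun y _ => this y)]
    simp only [Finset.sum_add_distrib, ← Finset.mul_sum]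
    rw [hχ, sum_quadraticChar_sub hp2, sum_quadraticChar_sub hp2, sum_quadraticChar_sub hp2,
      sum_quadraticChar_mul hp2 hab, sum_quadraticChar_mul hp2 hac, sum_quadraticChar_mul hp2 hbc]
    simp [ZMod.card]
    ring
  -- In the expansion only the triple product can cancel the main term p, so it must equal `w` at
  -- all but at most 8K + 27 elements. The cubic lemma then gives m ≤ 16K + 55, against the lower
  -- bound on p.
  set T : Finset (ZMod p) :=
    Finset.univ.filter (fun y => w * (χ (y - a) * χ (y - b) * χ (y - c)) ≠ 1) with hTdef
  have hle1 : ∀ y, w * (χ (y - a) * χ (y - b) * χ (y - c)) ≤ 1 := by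
    intro y
    rcases hw1 with h | h <;> rcases hval' (y - a) with h1 | h1 | h1 <;>
      rcases hval' (y - b) with h2 | h2 | h2 <;> rcases hval' (y - c) with h3 | h3 | h3 <;>
      simp [h, h1, h2, h3]
  have hTsum : ∑ y, w * (χ (y - a) * χ (y - b) * χ (y - c)) ≤ p - T.card := by
    have : ∀ y, w * (χ (y - a) * χ (y - b) * χ (y - c)) ≤
        1 - if w * (χ (y - a) * χ (y - b) * χ (y - c)) ≠ 1 then 1 else 0 := by
      intro y
      split_ifs with h
      · have := lt_of_le_of_ne (hle1 y) h; omega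
      · linarith [hle1 y]
    refine (Finset.sum_le_sum (fun y _ => this y)).trans ?_
    rw [Finset.sum_sub_distrib, Finset.sum_boole]
    simp [hTdef, ZMod.card]
  rw [← Finset.mul_sum] at hTsum
  have hTcard : T.card ≤ 8 * K + 27 := by
    have hst : -3 ≤ s * t * (-1) + s * u * (-1) + t * u * (-1) := by
      rcases hs with rfl | rfl <;> rcases ht with rfl | rfl <;> rcases hu with rfl | rfl <;>
        norm_num
    have : (T.card : ℤ) ≤ 8 * K + 27 := by
      rw [hexp] at hgsum
      have : w * ∑ y, χ (y - a) * χ (y - b) * χ (y - c) =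
        -(s * t * u * ∑ y, χ (y - a) * χ (y - b) * χ (y - c)) := by rw [hw]; ring
      linarith
    exact_mod_cast this
  have hfin := card_le_of_cubic_pow_eq_const hm hab hac (s := (w : ZMod p))
    (by rcases hw1 with h | h <;> simp [h]) T (by
      intro y hy
      have h1 : w * (χ (y - a) * χ (y - b) * χ (y - c)) = 1 := by
        by_contra hc; exact hy (by simp [hTdef, hc])
      have h2 : χ ((y - a) * (y - b) * (y - c)) = w := by
        rw [map_mul, map_mul]
        rcases hw1 with h | h <;> rw [h] at h1 ⊢ <;> linarith
      have h3 := quadraticChar_eq_pow_of_char_ne_two' hring ((y - a) * (y - b) * (y - c))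
      rw [← hχ, h2, ZMod.card] at h3
      rw [h3]; congr 1; omega)
  omega

end Markoff

namespace Markoff

/-! ### Invariants of Γ-orbits -/

section OrbitInduction

variable {R : Type*} [CommRing R]

theorem V1_apply (P : Params R) (v : Fin 3 → R) :
    V1 P v = ![P.A + v 1 * v 2 - v 0, v 1, v 2] := rfl

theorem V2_apply (P : Params R) (v : Fin 3 → R) :
    V2 P v = ![v 0, P.B + v 0 * v 2 - v 1, v 2] := rfl

theorem V3_apply (P : Params R) (v : Fin 3 → R) :
    V3 P v = ![v 0, v 1, P.C + v 0 * v 1 - v 2] := rfl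

theorem V1_mem (P : Params R) : V1 P ∈ vietaGroup P := Subgroup.subset_closure (by simp)

theorem V2_mem (P : Params R) : V2 P ∈ vietaGroup P := Subgroup.subset_closure (by simp)

theorem V3_mem (P : Params R) : V3 P ∈ vietaGroup P := Subgroup.subset_closure (by simp)

theorem V1_inv (P : Params R) : (V1 P)⁻¹ = V1 P := rfl

theorem V2_inv (P : Params R) : (V2 P)⁻¹ = V2 P := rfl

theorem V3_inv (P : Params R) : (V3 P)⁻¹ = V3 P := rfl

/-- The generators are their own inverses, so the inverse case of the closure induction is the same
as the direct one. -/
theorem orbit_induction {P : Params R} {w : Fin 3 → R} (Q : (Fin 3 → R) → Prop) (h0 : Q w)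
    (h1 : ∀ v, Q v → Q (V1 P v)) (h2 : ∀ v, Q v → Q (V2 P v)) (h3 : ∀ v, Q v → Q (V3 P v))
    {g : Equiv.Perm (Fin 3 → R)} (hg : g ∈ vietaGroup P) : Q (g w) := by
  refine Subgroup.closure_induction_left (p := fun g _ => Q (g w)) h0 ?_ ?_ hg
  · rintro x (rfl | rfl | rfl) y _ hy
    exacts [h1 _ hy, h2 _ hy, h3 _ hy]
  · rintro x (rfl | rfl | rfl) y _ hy
    exacts [h1 _ hy, h2 _ hy, h3 _ hy]

end OrbitInduction

/-! ### Orbit computations in ℤ[t] -/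

section Computation

/-- `(a₀, a₁, a₂)` stands for `a₀ + a₁ t + a₂ t²`. -/
abbrev Triple := ℤ × ℤ × ℤ

/-- The triples that represent `t²`, `t³` and `t⁴`. -/
structure PowerTable where
  sq : Triple
  cube : Triple
  fourth : Triple

def Triple.eval (t : ℝ) (a : Triple) : ℝ := a.1 + a.2.1 * t + a.2.2 * t ^ 2

def PowerTable.Valid (T : PowerTable) (t : ℝ) : Prop :=
  t ^ 2 = T.sq.eval t ∧ t ^ 3 = T.cube.eval t ∧ t ^ 4 = T.fourth.eval t

def PowerTable.mul (T : PowerTable) (a b : Triple) : Triple :=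
  let m := a.2.1 * b.2.1
  let n := a.2.1 * b.2.2 + a.2.2 * b.2.1
  let k := a.2.2 * b.2.2
  (a.1 * b.1 + m * T.sq.1 + n * T.cube.1 + k * T.fourth.1,
    a.1 * b.2.1 + a.2.1 * b.1 + m * T.sq.2.1 + n * T.cube.2.1 + k * T.fourth.2.1,
    a.1 * b.2.2 + a.2.2 * b.1 + m * T.sq.2.2 + n * T.cube.2.2 + k * T.fourth.2.2)

/-- `a + b c - d`. -/
def PowerTable.vieta (T : PowerTable) (a b c d : Triple) : Triple :=
  let m := T.mul b c
  (a.1 + m.1 - d.1, a.2.1 + m.2.1 - d.2.1, a.2.2 + m.2.2 - d.2.2)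

theorem PowerTable.eval_mul {T : PowerTable} {t : ℝ} (h : T.Valid t) (a b : Triple) :
    (T.mul a b).eval t = a.eval t * b.eval t := by
  obtain ⟨h2, h3, h4⟩ := h
  simp only [Triple.eval, PowerTable.mul] at *
  push_cast
  linear_combination (-(a.2.1 * b.2.1 : ℝ)) * h2 -
    (a.2.1 * b.2.2 + a.2.2 * b.2.1 : ℝ) * h3 - (a.2.2 * b.2.2 : ℝ) * h4

theorem PowerTable.eval_vieta {T : PowerTable} {t : ℝ} (h : T.Valid t) (a b c d : Triple) :
    (T.vieta a b c d).eval t = a.eval t + b.eval t * c.eval t - d.eval t := by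
  rw [← T.eval_mul h]
  simp only [Triple.eval, PowerTable.vieta]
  push_cast
  ring

/-- Triples for the parameters `A, B, C` or the coordinates `x, y, z`. -/
abbrev TriplePoint := Triple × Triple × Triple

def neighbours (T : PowerTable) (c v : TriplePoint) : List TriplePoint :=
  [(T.vieta c.1 v.2.1 v.2.2 v.1, v.2.1, v.2.2),
    (v.1, T.vieta c.2.1 v.1 v.2.2 v.2.1, v.2.2),
    (v.1, v.2.1, T.vieta c.2.2 v.1 v.2.1 v.2.2)]

/-- Depth first search for the orbit of a point. -/
def explore (T : PowerTable) (c : TriplePoint) :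
    ℕ → List TriplePoint → List TriplePoint → List TriplePoint
  | 0, _, seen => seen
  | _ + 1, [], seen => seen
  | n + 1, v :: todo, seen =>
    if v ∈ seen then explore T c n todo seen
    else explore T c n (neighbours T c v ++ todo) (v :: seen)

/-- Soundness rests only on the closure test, not on how the list was found. The fuel 300 suffices
for the largest orbit: each of its 72 points pushes three neighbours, so at most 1 + 3 · 72 entries
are popped. -/
def closesUp (T : PowerTable) (c v : TriplePoint) : Bool :=
  let l := explore T c 300 [v] []
  decide (v ∈ l) && l.all fun u => (neighbours T c u).all fun u' => decide (u' ∈ l)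

def TriplePoint.eval (t : ℝ) (v : TriplePoint) : Fin 3 → ℝ :=
  ![v.1.eval t, v.2.1.eval t, v.2.2.eval t]

open Polynomial in
/-- The coordinates of the orbit are roots of a single monic integral polynomial. -/
def HasIntegralFiniteOrbit (P : Params ℝ) (w : Fin 3 → ℝ) : Prop :=
  ∃ M : ℤ[X], M.Monic ∧ ∀ g ∈ vietaGroup P, ∀ i, aeval (g w i) M = 0

open Polynomial in
theorem exists_monic_of_isIntegral (l : List ℝ) (hl : ∀ x ∈ l, IsIntegral ℤ x) :
    ∃ M : ℤ[X], M.Monic ∧ ∀ x ∈ l, aeval x M = 0 := by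
  induction l with
  | nil => exact ⟨1, monic_one, by simp⟩
  | cons a l ih =>
    obtain ⟨M, hM, hM'⟩ := ih (fun x hx => hl x (by simp [hx]))
    obtain ⟨q, hq, hq'⟩ := hl a (by simp)
    refine ⟨q * M, hq.mul hM, ?_⟩
    intro x hx
    rcases List.mem_cons.1 hx with rfl | hx
    · rw [map_mul, aeval_def, hq', zero_mul]
    · rw [map_mul, hM' x hx, mul_zero]

/-- A list containing the base point and closed under the involutions contains the orbit. Its
entries lie in ℤ[t] with `t` integral, so finitely many monic polynomials, multiplied together, kill
all coordinates. -/
theorem hasIntegralFiniteOrbit_of_closesUp (T : PowerTable) (t : ℝ) (hT : T.Valid t)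
    (ht : IsIntegral ℤ t) (c v : TriplePoint) {P : Params ℝ} {w : Fin 3 → ℝ}
    (hP : P.coef = c.eval t) (hw : w = v.eval t) (h : closesUp T c v = true) :
    HasIntegralFiniteOrbit P w := by
  simp only [closesUp, Bool.and_eq_true, decide_eq_true_eq, List.all_eq_true] at h
  set l := explore T c 300 [v] [] with hl
  obtain ⟨hv, hcl⟩ := h
  have hint : ∀ a : Triple, IsIntegral ℤ (a.eval t) := fun a => by
    have hc : ∀ n : ℤ, IsIntegral ℤ (n : ℝ) := fun n => isIntegral_algebraMap (A := ℝ) (x := n)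
    exact ((hc _).add ((hc _).mul ht)).add ((hc _).mul (ht.pow 2))
  obtain ⟨M, hM, hM'⟩ := exists_monic_of_isIntegral
    (l.flatMap fun u => [u.1.eval t, u.2.1.eval t, u.2.2.eval t]) (by
      intro x hx
      simp only [List.mem_flatMap, List.mem_cons, List.not_mem_nil, or_false] at hx
      obtain ⟨u, _, rfl | rfl | rfl⟩ := hx <;> exact hint _)
  refine ⟨M, hM, fun g hg i => ?_⟩
  have hA : P.A = c.1.eval t := by simp [Params.A, hP, TriplePoint.eval]
  have hB : P.B = c.2.1.eval t := by simp [Params.B, hP, TriplePoint.eval]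
  have hC : P.C = c.2.2.eval t := by simp [Params.C, hP, TriplePoint.eval]
  have key : ∃ u ∈ l, g w = TriplePoint.eval t u := by
    refine orbit_induction (fun x => ∃ u ∈ l, x = TriplePoint.eval t u) ⟨v, hv, hw⟩ ?_ ?_ ?_ hg
    · rintro _ ⟨u, hu, rfl⟩
      exact ⟨_, hcl u hu _ (List.mem_cons_self ..), by
        simp [V1_apply, TriplePoint.eval, T.eval_vieta hT, hA]⟩
    · rintro _ ⟨u, hu, rfl⟩
      exact ⟨_, hcl u hu _ (List.mem_cons_of_mem _ (List.mem_cons_self ..)), by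
        simp [V2_apply, TriplePoint.eval, T.eval_vieta hT, hB]⟩
    · rintro _ ⟨u, hu, rfl⟩
      exact ⟨_, hcl u hu _
        (List.mem_cons_of_mem _ (List.mem_cons_of_mem _ (List.mem_cons_self ..))), by
        simp [V3_apply, TriplePoint.eval, T.eval_vieta hT, hC]⟩
  obtain ⟨u, hu, hgu⟩ := key
  rw [hgu]
  apply hM'
  simp only [List.mem_flatMap, List.mem_cons, List.not_mem_nil, or_false]
  exact ⟨u, hu, by fin_cases i <;> simp [TriplePoint.eval]⟩

/-- The table for `t² = a + b t`. -/
def quadraticTable (a b : ℤ) : PowerTable :=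
  ⟨(a, b, 0), (a * b, a + b ^ 2, 0), (a * (a + b ^ 2), a * b + b * (a + b ^ 2), 0)⟩

/-- The table for `t³ = 1 + 2 t - t²`. -/
def heptagonTable : PowerTable := ⟨(0, 0, 1), (1, 2, -1), (-1, -1, 3)⟩

theorem quadraticTable_valid {a b : ℤ} {t : ℝ} (h : t ^ 2 = a + b * t) :
    (quadraticTable a b).Valid t := by
  refine ⟨?_, ?_, ?_⟩ <;> simp only [quadraticTable, Triple.eval] <;> push_cast
  · linear_combination h
  · linear_combination (t + b) * h
  · linear_combination (t ^ 2 + b * t + a + b ^ 2) * h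

theorem heptagonTable_valid {t : ℝ} (h : t ^ 3 = 1 + 2 * t - t ^ 2) : heptagonTable.Valid t := by
  refine ⟨?_, ?_, ?_⟩ <;> simp only [heptagonTable, Triple.eval] <;> push_cast
  · ring
  · linear_combination h
  · linear_combination (t - 1) * h

end Computation
end Markoff

namespace Markoff

/-! ### Integrality and finiteness of the exceptional orbits -/

section ExceptionalOrbits

open Real

theorem cos_half (t : ℝ) : -2 * cos (π * (1 / 2)) = Triple.eval t (0, 0, 0) := by
  rw [mul_one_div, cos_pi_div_two]; simp [Triple.eval]

theorem cos_third (t : ℝ) : -2 * cos (π * (1 / 3)) = Triple.eval t (-1, 0, 0) := by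
  rw [mul_one_div, cos_pi_div_three]; simp [Triple.eval]

theorem cos_two_thirds (t : ℝ) : -2 * cos (π * (2 / 3)) = Triple.eval t (1, 0, 0) := by
  rw [show π * (2 / 3) = π - π / 3 by ring, cos_pi_sub, cos_pi_div_three]; simp [Triple.eval]

theorem cos_fourth : -2 * cos (π * (1 / 4)) = Triple.eval √2 (0, -1, 0) := by
  rw [mul_one_div, cos_pi_div_four]; simp [Triple.eval]; ring

theorem cos_fifth : -2 * cos (π * (1 / 5)) = Triple.eval ((1 + √5) / 2) (0, -1, 0) := by
  rw [mul_one_div, cos_pi_div_five]; simp [Triple.eval]; ring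

theorem cos_two_fifths : -2 * cos (π * (2 / 5)) = Triple.eval ((1 + √5) / 2) (1, -1, 0) := by
  rw [show π * (2 / 5) = 2 * (π / 5) by ring, cos_two_mul, cos_pi_div_five]
  have : √5 ^ 2 = 5 := sq_sqrt (by norm_num)
  simp only [Triple.eval]
  push_cast
  linear_combination (-(1 / 4 : ℝ)) * this

theorem cos_three_fifths : -2 * cos (π * (3 / 5)) = Triple.eval ((1 + √5) / 2) (-1, 1, 0) := by
  rw [show π * (3 / 5) = π - π * (2 / 5) by ring, cos_pi_sub]
  have := cos_two_fifths
  simp only [Triple.eval] at this ⊢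
  push_cast at this ⊢
  linarith

theorem hasIntegralFiniteOrbit_mkSeed {T : PowerTable} {t : ℝ} (hT : T.Valid t)
    (ht : IsIntegral ℤ t) (c v : TriplePoint) {a b e d x y z : ℝ}
    (h : -a = c.1.eval t ∧ -b = c.2.1.eval t ∧ -e = c.2.2.eval t)
    (hx : -2 * cos (π * x) = v.1.eval t) (hy : -2 * cos (π * y) = v.2.1.eval t)
    (hz : -2 * cos (π * z) = v.2.2.eval t) (hcl : closesUp T c v = true) :
    HasIntegralFiniteOrbit (mkSeed a b e d x y z).1 (mkSeed a b e d x y z).2 := by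
  refine hasIntegralFiniteOrbit_of_closesUp T t hT ht c v ?_ ?_ hcl
  · simp only [mkSeed, TriplePoint.eval, h.1, h.2.1, h.2.2]
  · simp only [mkSeed, TriplePoint.eval, hx, hy, hz]

open Polynomial in
theorem isIntegral_of_sq_eq {a b : ℤ} {t : ℝ} (h : t ^ 2 = a + b * t) : IsIntegral ℤ t := by
  refine ⟨X ^ 2 - (C b * X + C a), ?_, ?_⟩
  · exact monic_X_pow_sub (lt_of_le_of_lt degree_linear_le (by norm_num))
  · simp only [eval₂_add, eval₂_sub, eval₂_mul, eval₂_pow, eval₂_X, eval₂_C, h, algebraMap_int_eq]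
    simp only [eq_intCast]
    ring

theorem two_sq : √2 ^ 2 = (2 : ℤ) + (0 : ℤ) * √2 := by
  rw [sq_sqrt (by norm_num)]; simp

theorem golden_sq : ((1 + √5) / 2) ^ 2 = (1 : ℤ) + (1 : ℤ) * ((1 + √5) / 2) := by
  have : √5 ^ 2 = 5 := sq_sqrt (by norm_num)
  push_cast
  linear_combination (1 / 4 : ℝ) * this

/-- With θ = 2πk/7 one has cos 4θ = cos 3θ. As a quartic in cos θ this has the factor cos θ - 1,
nonzero because 0 < θ < 2π; the cubic cofactor is the relation. -/
theorem heptagon_cube {k : ℝ} (h0 : 0 < k) (h7 : k < 7) (hk : ∃ n : ℤ, k = n) :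
    c7 k ^ 3 = 1 + 2 * c7 k - c7 k ^ 2 := by
  obtain ⟨n, hn⟩ := hk
  set θ := 2 * π * k / 7 with hθ
  have hne : cos θ ≠ 1 := by
    have h1 : 0 < θ := by positivity
    have h2 : θ < 2 * π := by
      rw [hθ, div_lt_iff₀ (by norm_num)]; nlinarith [pi_pos]
    rw [Ne, cos_eq_one_iff_of_lt_of_lt (by linarith [pi_pos]) h2]
    exact h1.ne'
  have h4 : cos (4 * θ) = cos (3 * θ) := by
    rw [show 4 * θ = n * (2 * π) - 3 * θ by rw [hθ, hn]; ring, cos_int_mul_two_pi_sub]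
  rw [show 4 * θ = 2 * (2 * θ) by ring, cos_two_mul, cos_two_mul, cos_three_mul] at h4
  have h5 : (cos θ - 1) * (8 * cos θ ^ 3 + 4 * cos θ ^ 2 - 4 * cos θ - 1) = 0 := by
    linear_combination h4
  have h6 := (mul_eq_zero.1 h5).resolve_left (sub_ne_zero.2 hne)
  have : c7 k = 2 * cos θ := rfl
  rw [this]
  linear_combination h6

open Polynomial in
theorem heptagon_isIntegral {t : ℝ} (h : t ^ 3 = 1 + 2 * t - t ^ 2) : IsIntegral ℤ t := by
  refine ⟨X ^ 3 - (-X ^ 2 + 2 * X + 1), ?_, ?_⟩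
  · refine monic_X_pow_sub ?_
    compute_degree!
  · simp [eval₂_add, eval₂_sub, eval₂_mul, h]; ring

/-- Also serves the seeds with rational data, whose triples only use the first entry. The parameter
D never enters the involutions and is left free. -/
theorem goldenSeed (c v : TriplePoint) {a b e d x y z : ℝ}
    (h : -a = c.1.eval ((1 + √5) / 2) ∧ -b = c.2.1.eval ((1 + √5) / 2) ∧
      -e = c.2.2.eval ((1 + √5) / 2))
    (hx : -2 * cos (π * x) = v.1.eval ((1 + √5) / 2))
    (hy : -2 * cos (π * y) = v.2.1.eval ((1 + √5) / 2))
    (hz : -2 * cos (π * z) = v.2.2.eval ((1 + √5) / 2))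
    (hcl : closesUp (quadraticTable 1 1) c v = true) :
    HasIntegralFiniteOrbit (mkSeed a b e d x y z).1 (mkSeed a b e d x y z).2 :=
  hasIntegralFiniteOrbit_mkSeed (quadraticTable_valid golden_sq) (isIntegral_of_sq_eq golden_sq)
    c v h hx hy hz hcl

theorem twoSeed (c v : TriplePoint) {a b e d x y z : ℝ}
    (h : -a = c.1.eval √2 ∧ -b = c.2.1.eval √2 ∧ -e = c.2.2.eval √2)
    (hx : -2 * cos (π * x) = v.1.eval √2) (hy : -2 * cos (π * y) = v.2.1.eval √2)
    (hz : -2 * cos (π * z) = v.2.2.eval √2)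
    (hcl : closesUp (quadraticTable 2 0) c v = true) :
    HasIntegralFiniteOrbit (mkSeed a b e d x y z).1 (mkSeed a b e d x y z).2 :=
  hasIntegralFiniteOrbit_mkSeed (quadraticTable_valid two_sq) (isIntegral_of_sq_eq two_sq)
    c v h hx hy hz hcl

theorem heptagonSeed {k : ℝ} (hk : k = 1 ∨ k = 2 ∨ k = 3) (c v : TriplePoint)
    {a b e d x y z : ℝ}
    (h : -a = c.1.eval (c7 k) ∧ -b = c.2.1.eval (c7 k) ∧ -e = c.2.2.eval (c7 k))
    (hx : -2 * cos (π * x) = v.1.eval (c7 k)) (hy : -2 * cos (π * y) = v.2.1.eval (c7 k))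
    (hz : -2 * cos (π * z) = v.2.2.eval (c7 k)) (hcl : closesUp heptagonTable c v = true) :
    HasIntegralFiniteOrbit (mkSeed a b e d x y z).1 (mkSeed a b e d x y z).2 := by
  have h7 : c7 k ^ 3 = 1 + 2 * c7 k - c7 k ^ 2 := by
    apply heptagon_cube
    · rcases hk with rfl | rfl | rfl <;> norm_num
    · rcases hk with rfl | rfl | rfl <;> norm_num
    · rcases hk with rfl | rfl | rfl
      exacts [⟨1, by simp⟩, ⟨2, by simp⟩, ⟨3, by simp⟩]
  exact hasIntegralFiniteOrbit_mkSeed (heptagonTable_valid h7) (heptagon_isIntegral h7)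
    c v h hx hy hz hcl

theorem hasIntegralFiniteOrbit_exceptionalSeeds :
    ∀ s ∈ exceptionalSeeds, HasIntegralFiniteOrbit s.1 s.2 := by
  simp only [exceptionalSeeds, List.forall_mem_cons]
  refine ⟨goldenSeed ((0, 0, 0), (-1, 0, 0), (-1, 0, 0)) ((0, 0, 0), (0, 0, 0), (0, 0, 0)) ?_
    (cos_half _) (cos_half _) (cos_half _) (by decide +kernel),
    goldenSeed ((-3, 0, 0), (-2, 0, 0), (-2, 0, 0)) ((-1, 0, 0), (-1, 0, 0), (0, 0, 0)) ?_
    (cos_third _) (cos_third _) (cos_half _) (by decide +kernel),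
    goldenSeed ((-1, 0, 0), (0, 0, 0), (0, 0, 0)) ((0, 0, 0), (-1, 0, 0), (-1, 0, 0)) ?_
    (cos_half _) (cos_third _) (cos_third _) (by decide +kernel),
    twoSeed ((0, -1, 0), (0, 0, 0), (0, 0, 0)) ((0, 0, 0), (-1, 0, 0), (0, 0, 0)) ?_
    (cos_half _) (cos_third _) (cos_half _) (by decide +kernel),
    goldenSeed ((-2, 2, 0), (-2, 1, 0), (-2, 1, 0)) ((-1, 1, 0), (-1, 0, 0), (0, 0, 0)) ?_
    cos_three_fifths (cos_third _) (cos_half _) (by decide +kernel),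
    twoSeed ((-3, 0, 0), (0, -2, 0), (0, -2, 0)) ((-1, 0, 0), (0, -1, 0), (0, 0, 0)) ?_
    (cos_third _) cos_fourth (cos_half _) (by decide +kernel),
    goldenSeed ((0, -2, 0), (-1, -1, 0), (-1, -1, 0)) ((0, -1, 0), (-1, 0, 0), (0, 0, 0)) ?_
    cos_fifth (cos_third _) (cos_half _) (by decide +kernel),
    goldenSeed ((-1, 0, 0), (-1, 0, 0), (-1, 0, 0)) ((0, 0, 0), (0, 0, 0), (0, 0, 0)) ?_
    (cos_half _) (cos_half _) (cos_half _) (by decide +kernel),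
    goldenSeed ((-2, 1, 0), (-1, 0, 0), (-1, 0, 0)) ((-1, 0, 0), (0, 0, 0), (0, 0, 0)) ?_
    (cos_third _) (cos_half _) (cos_half _) (by decide +kernel),
    goldenSeed ((-2, 0, 0), (0, 0, 0), (0, 0, 0)) ((-1, 0, 0), (-1, 0, 0), (0, 0, 0)) ?_
    (cos_third _) (cos_third _) (cos_half _) (by decide +kernel),
    twoSeed ((-1, 0, 0), (0, -1, 0), (0, -1, 0)) ((0, 0, 0), (0, 0, 0), (0, 0, 0)) ?_
    (cos_half _) (cos_half _) (cos_half _) (by decide +kernel),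
    goldenSeed ((-1, -1, 0), (-1, 0, 0), (-1, 0, 0)) ((-1, 0, 0), (0, 0, 0), (0, 0, 0)) ?_
    (cos_third _) (cos_half _) (cos_half _) (by decide +kernel),
    goldenSeed ((-3, 2, 0), (-3, 2, 0), (-3, 2, 0)) ((-1, 0, 0), (-1, 0, 0), (-1, 1, 0)) ?_
    (cos_third _) (cos_third _) cos_three_fifths (by decide +kernel),
    goldenSeed ((-1, -2, 0), (-1, -2, 0), (-1, -2, 0)) ((0, -1, 0), (-1, 0, 0), (-1, 0, 0)) ?_
    cos_fifth (cos_third _) (cos_third _) (by decide +kernel),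
    goldenSeed ((-4, 2, 0), (-4, 2, 0), (-4, 2, 0)) ((-1, 0, 0), (-1, 1, 0), (-1, 1, 0)) ?_
    (cos_third _) cos_three_fifths cos_three_fifths (by decide +kernel),
    goldenSeed ((-1, 0, 0), (0, 0, 0), (0, 0, 0)) ((0, 0, 0), (-1, 0, 0), (0, 0, 0)) ?_
    (cos_half _) (cos_third _) (cos_half _) (by decide +kernel),
    goldenSeed ((0, -1, 0), (0, -1, 0), (0, -1, 0)) ((0, 0, 0), (0, 0, 0), (0, 0, 0)) ?_
    (cos_half _) (cos_half _) (cos_half _) (by decide +kernel),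
    goldenSeed ((-1, 1, 0), (-1, 1, 0), (-1, 1, 0)) ((0, 0, 0), (0, 0, 0), (0, 0, 0)) ?_
    (cos_half _) (cos_half _) (cos_half _) (by decide +kernel),
    goldenSeed ((-2, -2, 0), (-2, -2, 0), (-2, -2, 0)) ((0, -1, 0), (0, -1, 0), (-1, 0, 0)) ?_
    cos_fifth cos_fifth (cos_third _) (by decide +kernel),
    twoSeed ((0, 0, 0), (0, 0, 0), (0, 0, 0)) ((0, -1, 0), (-1, 0, 0), (0, 0, 0)) ?_
    cos_fourth (cos_third _) (cos_half _) (by decide +kernel),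
    goldenSeed ((-2, 1, 0), (1, -1, 0), (1, -1, 0)) ((-1, 0, 0), (0, 0, 0), (1, 0, 0)) ?_
    (cos_third _) (cos_half _) (cos_two_thirds _) (by decide +kernel),
    twoSeed ((-1, 0, 0), (0, 0, 0), (0, 0, 0)) ((0, 0, 0), (0, -1, 0), (0, 0, 0)) ?_
    (cos_half _) cos_fourth (cos_half _) (by decide +kernel),
    goldenSeed ((0, -1, 0), (-1, 0, 0), (1, -1, 0)) ((0, 0, 0), (0, 0, 0), (0, 0, 0)) ?_
    (cos_half _) (cos_half _) (cos_half _) (by decide +kernel),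
    goldenSeed ((-2, 0, 0), (1, -2, 0), (1, -2, 0)) ((-1, 0, 0), (0, -1, 0), (0, 0, 0)) ?_
    (cos_third _) cos_fifth (cos_half _) (by decide +kernel),
    goldenSeed ((-1, -1, 0), (0, -1, 0), (0, -1, 0)) ((-1, 0, 0), (-1, 0, 0), (0, 0, 0)) ?_
    (cos_third _) (cos_third _) (cos_half _) (by decide +kernel),
    goldenSeed ((-2, 1, 0), (-2, 1, 0), (-2, 1, 0)) ((-1, 0, 0), (-1, 0, 0), (0, 0, 0)) ?_
    (cos_third _) (cos_third _) (cos_half _) (by decide +kernel),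
    goldenSeed ((-3, 1, 0), (2, -2, 0), (2, -2, 0)) ((-1, 0, 0), (0, -1, 0), (1, 0, 0)) ?_
    (cos_third _) cos_fifth (cos_two_thirds _) (by decide +kernel),
    goldenSeed ((-1, -1, 0), (-1, -1, 0), (-1, -1, 0)) ((-1, 0, 0), (-1, 0, 0), (0, 0, 0)) ?_
    (cos_third _) (cos_third _) (cos_half _) (by decide +kernel),
    goldenSeed ((-2, -1, 0), (0, -2, 0), (0, -2, 0)) ((-1, 0, 0), (0, -1, 0), (-1, 0, 0)) ?_
    (cos_third _) cos_fifth (cos_third _) (by decide +kernel),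
    goldenSeed ((0, 0, 0), (0, 0, 0), (0, 0, 0)) ((-1, 0, 0), (-1, 0, 0), (0, 0, 0)) ?_
    (cos_third _) (cos_third _) (cos_half _) (by decide +kernel),
    heptagonSeed (.inl rfl) ((-1, 1, 0), (-1, 1, 0), (-1, 1, 0)) ((-1, 0, 0), (-1, 0, 0), (0, 0, 0)) ?_
    (cos_third _) (cos_third _) (cos_half _) (by decide +kernel),
    heptagonSeed (.inr (.inl rfl)) ((-1, 1, 0), (-1, 1, 0), (-1, 1, 0)) ((-1, 0, 0), (-1, 0, 0), (0, 0, 0)) ?_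
    (cos_third _) (cos_third _) (cos_half _) (by decide +kernel),
    goldenSeed ((-2, 0, 0), (-2, 0, 0), (-2, 0, 0)) ((0, -1, 0), (-1, 0, 0), (-1, 0, 0)) ?_
    cos_fifth (cos_third _) (cos_third _) (by decide +kernel),
    heptagonSeed (.inr (.inr rfl)) ((-1, 1, 0), (-1, 1, 0), (-1, 1, 0)) ((-1, 0, 0), (-1, 0, 0), (0, 0, 0)) ?_
    (cos_third _) (cos_third _) (cos_half _) (by decide +kernel),
    goldenSeed ((-2, 1, 0), (0, 0, 0), (0, 0, 0)) ((-1, 0, 0), (0, -1, 0), (0, 0, 0)) ?_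
    (cos_third _) cos_fifth (cos_half _) (by decide +kernel),
    goldenSeed ((-1, 0, 0), (1, -1, 0), (1, -1, 0)) ((0, 0, 0), (0, 0, 0), (1, 0, 0)) ?_
    (cos_half _) (cos_half _) (cos_two_thirds _) (by decide +kernel),
    goldenSeed ((-1, 0, 0), (0, -1, 0), (0, -1, 0)) ((0, 0, 0), (-1, 0, 0), (0, 0, 0)) ?_
    (cos_half _) (cos_third _) (cos_half _) (by decide +kernel),
    goldenSeed ((-1, -1, 0), (0, 0, 0), (0, 0, 0)) ((-1, 0, 0), (1, -1, 0), (0, 0, 0)) ?_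
    (cos_third _) cos_two_fifths (cos_half _) (by decide +kernel),
    goldenSeed ((-1, 0, 0), (-1, 0, 0), (-1, 0, 0)) ((0, -1, 0), (0, 0, 0), (0, 0, 0)) ?_
    cos_fifth (cos_half _) (cos_half _) (by decide +kernel),
    goldenSeed ((1, -1, 0), (0, 0, 0), (0, 0, 0)) ((1, 0, 0), (-1, 0, 0), (0, 0, 0)) ?_
    (cos_two_thirds _) (cos_third _) (cos_half _) (by decide +kernel),
    goldenSeed ((0, -1, 0), (0, 0, 0), (0, 0, 0)) ((-1, 0, 0), (-1, 0, 0), (0, 0, 0)) ?_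
    (cos_third _) (cos_third _) (cos_half _) (by decide +kernel),
    goldenSeed ((-1, 0, 0), (0, 0, 0), (0, 0, 0)) ((0, -1, 0), (-1, 0, 0), (0, 0, 0)) ?_
    cos_fifth (cos_third _) (cos_half _) (by decide +kernel),
    goldenSeed ((0, 0, 0), (0, 0, 0), (0, 0, 0)) ((0, -1, 0), (-1, 0, 0), (0, 0, 0)) ?_
    cos_fifth (cos_third _) (cos_half _) (by decide +kernel),
    goldenSeed ((0, 0, 0), (0, 0, 0), (0, 0, 0)) ((-1, 0, 0), (1, -1, 0), (0, 0, 0)) ?_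
    (cos_third _) cos_two_fifths (cos_half _) (by decide +kernel),
    goldenSeed ((0, 0, 0), (0, 0, 0), (0, 0, 0)) ((0, -1, 0), (-1, 0, 0), (1, 0, 0)) ?_
    cos_fifth (cos_third _) (cos_two_thirds _) (by decide +kernel),
    by simp⟩
  -- What is left are the identities between the listed parameters and their triples.
  all_goals
    simp only [Triple.eval]
    push_cast
    refine ⟨by ring, by ring, by ring⟩

end ExceptionalOrbits

end Markoff

namespace Markoff

/-! ### Coordinates occurring in small orbits -/

section

variable {R : Type*}

@[simp]
theorem Params.A_mk (a b c d : R) : (⟨![a, b, c], d⟩ : Params R).A = a := rfl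

@[simp]
theorem Params.B_mk (a b c d : R) : (⟨![a, b, c], d⟩ : Params R).B = b := rfl

@[simp]
theorem Params.C_mk (a b c d : R) : (⟨![a, b, c], d⟩ : Params R).C = c := rfl

end

open Polynomial in
/-- All coordinates of a reduced exceptional orbit are roots of the reduction of an integral
polynomial. -/
theorem IsReduction.aeval_eq_zero {F : Type*} [CommRing F] {P₀ : Params ℝ} {w₀ : Fin 3 → ℝ}
    {P : Params F} {w : Fin 3 → F} (h : IsReduction P₀ w₀ P w) {M : ℤ[X]}
    (hM : ∀ g ∈ vietaGroup P₀, ∀ i, aeval (g w₀ i) M = 0) {g : Equiv.Perm (Fin 3 → F)}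
    (hg : g ∈ vietaGroup P) (i : Fin 3) : aeval (g w i) M = 0 := by
  obtain ⟨R, φ, Q, u, rfl, hu, rfl, hw⟩ := h
  -- The involutions are polynomial in parameters and coordinates, so the orbit lifts to the subring
  -- `R` and can be seen both in ℝ and in `F`.
  have key : ∃ x : Fin 3 → R, g w = φ ∘ x ∧ ∃ g₀ ∈ vietaGroup (Q.map R.subtype),
      g₀ w₀ = R.subtype ∘ x := by
    refine orbit_induction (fun v => ∃ x : Fin 3 → R, v = φ ∘ x ∧
      ∃ g₀ ∈ vietaGroup (Q.map R.subtype), g₀ w₀ = R.subtype ∘ x) ?_ ?_ ?_ ?_ hg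
    · exact ⟨u, funext fun i => (hw i).symm, 1, one_mem _, funext fun i => (hu i).symm⟩
    · rintro _ ⟨x, rfl, g₀, hg₀, hx⟩
      refine ⟨V1 Q x, ?_, V1 _ * g₀, mul_mem (V1_mem _) hg₀, ?_⟩
      · ext i; fin_cases i <;> simp [V1_apply, Params.map]
      · rw [Equiv.Perm.mul_apply, hx]; ext i; fin_cases i <;> simp [V1_apply, Params.map]
    · rintro _ ⟨x, rfl, g₀, hg₀, hx⟩
      refine ⟨V2 Q x, ?_, V2 _ * g₀, mul_mem (V2_mem _) hg₀, ?_⟩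
      · ext i; fin_cases i <;> simp [V2_apply, Params.map]
      · rw [Equiv.Perm.mul_apply, hx]; ext i; fin_cases i <;> simp [V2_apply, Params.map]
    · rintro _ ⟨x, rfl, g₀, hg₀, hx⟩
      refine ⟨V3 Q x, ?_, V3 _ * g₀, mul_mem (V3_mem _) hg₀, ?_⟩
      · ext i; fin_cases i <;> simp [V3_apply, Params.map]
      · rw [Equiv.Perm.mul_apply, hx]; ext i; fin_cases i <;> simp [V3_apply, Params.map]
  obtain ⟨x, hx, g₀, hg₀, hx₀⟩ := key
  have h1 := hM g₀ hg₀ i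
  rw [hx₀] at h1
  have h2 : aeval (x i) M = 0 := by
    apply Subtype.val_injective
    exact (aeval_algHom_apply R.subtype.toIntAlgHom (x i) M).symm.trans h1
  have h3 := aeval_algHom_apply φ.toIntAlgHom (x i) M
  rw [h2, map_zero] at h3
  rw [hx]
  exact h3

-- A single monic integral polynomial serves all exceptional orbits. Being monic, it stays nonzero
-- modulo every p, so its roots number at most its degree, uniformly in p.
open Polynomial in
theorem exists_exceptional_polynomial : ∃ M : ℤ[X], M.Monic ∧
    ∀ s ∈ exceptionalSeeds, ∀ g ∈ vietaGroup s.1, ∀ i, aeval (g s.2 i) M = 0 := by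
  have := hasIntegralFiniteOrbit_exceptionalSeeds
  revert this
  induction exceptionalSeeds with
  | nil => exact fun _ => ⟨1, monic_one, by simp⟩
  | cons s l ih =>
    intro this
    obtain ⟨M, hM, hM'⟩ := ih fun x hx => this x (by simp [hx])
    obtain ⟨q, hq, hq'⟩ := this s (by simp)
    refine ⟨q * M, hq.mul hM, fun x hx g hg i => ?_⟩
    rcases List.mem_cons.1 hx with rfl | hx
    · rw [map_mul, hq' g hg, zero_mul]
    · rw [map_mul, hM' x hx g hg, mul_zero]

open Polynomial in
/-- The first coordinates of the points that are fixed by all Vieta involutions are roots of this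
polynomial. -/
noncomputable def fixedPoly {F : Type*} [CommRing F] (a b c : F) : F[X] :=
  (4 - X ^ 2) ^ 2 * (2 * X - C a) - (2 * C b + C c * X) * (2 * C c + C b * X)

open Polynomial in
theorem fixedPoly_natDegree_le {F : Type*} [CommRing F] (a b c : F) :
    (fixedPoly a b c).natDegree ≤ 5 := by
  unfold fixedPoly
  compute_degree

open Polynomial in
theorem fixedPoly_ne_zero {F : Type*} [Field F] (h2 : (2 : F) ≠ 0) (a b c : F) :
    fixedPoly a b c ≠ 0 := by
  intro h
  have h5 : (fixedPoly a b c).coeff 5 = 2 := by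
    unfold fixedPoly
    compute_degree!
  rw [h] at h5
  exact h2 (by simpa using h5.symm)

/-- The last two equations form a linear system for y, z with determinant 4 - x². Multiplying the
first by (4 - x²)² eliminates y and z without division. -/
theorem fixedPoly_eval {F : Type*} [CommRing F] {a b c x y z : F} (h1 : 2 * x = a + y * z)
    (h2 : 2 * y = b + x * z) (h3 : 2 * z = c + x * y) : (fixedPoly a b c).eval x = 0 := by
  simp only [fixedPoly, Polynomial.eval_sub, Polynomial.eval_mul, Polynomial.eval_add,
    Polynomial.eval_pow, Polynomial.eval_X, Polynomial.eval_C, Polynomial.eval_ofNat]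
  have hy : (4 - x ^ 2) * y = 2 * b + c * x := by linear_combination 2 * h2 + x * h3
  have hz : (4 - x ^ 2) * z = 2 * c + b * x := by linear_combination 2 * h3 + x * h2
  rw [← hy, ← hz]
  linear_combination (4 - x ^ 2) ^ 2 * h1

open Polynomial in
/-- The coordinates of the points in small orbits lie in a set of bounded size. -/
theorem exists_finset_seedOrbits : ∃ K : ℕ, ∀ p : ℕ, ∀ [Fact p.Prime], p ≠ 2 →
    ∀ P : Params (ZMod p), ∃ R : Finset (ZMod p), R.card ≤ K ∧
      ∀ w, IsSmallSeed P w → ∀ g ∈ vietaGroup P, ∀ i, g w i ∈ R := by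
  classical
  obtain ⟨M, hM, hM'⟩ := exists_exceptional_polynomial
  -- Exceptional orbits, the three coordinates of fixed points, the quadratic of type II, and five
  -- explicit values.
  refine ⟨M.natDegree + 5 + 5 + 5 + 2 + 5, fun p _ hp P => ?_⟩
  have h2 : (2 : ZMod p) ≠ 0 := by
    intro h
    have : ((2 : ℕ) : ZMod p) = 0 := by exact_mod_cast h
    rw [ZMod.natCast_eq_zero_iff] at this
    exact hp ((Nat.prime_dvd_prime_iff_eq Fact.out Nat.prime_two).1 this)
  let rt : (ZMod p)[X] → Finset (ZMod p) := fun q => q.roots.toFinset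
  have hrt : ∀ (q : (ZMod p)[X]) (n : ℕ), q.natDegree ≤ n → (rt q).card ≤ n := fun q n h =>
    (Multiset.toFinset_card_le _).trans ((card_roots' q).trans h)
  have hmem : ∀ (q : (ZMod p)[X]) x, q ≠ 0 → q.eval x = 0 → x ∈ rt q := fun q x h0 h => by
    simp only [rt, Multiset.mem_toFinset]; exact (mem_roots h0).2 h
  let q : (ZMod p)[X] := X ^ 2 - (C P.A * X + C P.D)
  have hqdeg : q.natDegree ≤ 2 := by simp only [q]; compute_degree
  have hq0 : q ≠ 0 := (monic_X_pow_sub (lt_of_le_of_lt degree_linear_le (by norm_num))).ne_zero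
  let Mp : (ZMod p)[X] := M.map (Int.castRingHom (ZMod p))
  have hMp0 : Mp ≠ 0 := (hM.map _).ne_zero
  have hMpdeg : Mp.natDegree ≤ M.natDegree := natDegree_map_le
  -- `P.B` is k in type III and `P.A + 2` is k + 2 in type IV; the repeated -1 only pads the set to
  -- five entries.
  refine ⟨rt Mp ∪ rt (fixedPoly P.A P.B P.C) ∪ rt (fixedPoly P.B P.A P.C) ∪
    rt (fixedPoly P.C P.A P.B) ∪ rt q ∪ {-1, 0, P.B, P.A + 2, -1}, ?_, ?_⟩
  · refine (Finset.card_union_le _ _).trans (add_le_add ?_ Finset.card_le_five)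
    refine (Finset.card_union_le _ _).trans (add_le_add ?_ (hrt _ _ hqdeg))
    refine (Finset.card_union_le _ _).trans (add_le_add ?_ (hrt _ _ (fixedPoly_natDegree_le ..)))
    refine (Finset.card_union_le _ _).trans (add_le_add ?_ (hrt _ _ (fixedPoly_natDegree_le ..)))
    refine (Finset.card_union_le _ _).trans (add_le_add ?_ (hrt _ _ (fixedPoly_natDegree_le ..)))
    exact hrt _ _ hMpdeg
  intro w hw g hg i
  simp only [Finset.mem_union, Finset.mem_insert, Finset.mem_singleton]
  cases hw with
  | typeI _ _ hw h1 h2 h3 =>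
    have hgw : g w = w := by
      refine orbit_induction (fun v => v = w) rfl ?_ ?_ ?_ hg <;> rintro v rfl <;> assumption
    rw [hgw]
    have e1 := congrFun h1 0
    have e2 := congrFun h2 1
    have e3 := congrFun h3 2
    simp only [V1_apply, V2_apply, V3_apply, Matrix.cons_val_zero, Matrix.cons_val_one,
      Matrix.cons_val] at e1 e2 e3
    have f : ∀ a b c : ZMod p, fixedPoly a b c ≠ 0 := fixedPoly_ne_zero ‹_›
    have m1 := hmem _ (w 0) (f P.A P.B P.C) (fixedPoly_eval (y := w 1) (z := w 2)
      (by linear_combination -e1) (by linear_combination -e2) (by linear_combination -e3))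
    have m2 := hmem _ (w 1) (f P.B P.A P.C) (fixedPoly_eval (y := w 0) (z := w 2)
      (by linear_combination -e2) (by linear_combination -e1) (by linear_combination -e3))
    have m3 := hmem _ (w 2) (f P.C P.A P.B) (fixedPoly_eval (y := w 0) (z := w 1)
      (by linear_combination -e3) (by linear_combination -e1) (by linear_combination -e2))
    fin_cases i <;> simp [m1, m2, m3]
  | typeII a d r s hrs hr hs =>
    have hgw : ∃ x : ZMod p, q.eval x = 0 ∧ g ![r, 0, 0] = ![x, 0, 0] := by
      refine orbit_induction (fun v => ∃ x : ZMod p, q.eval x = 0 ∧ v = ![x, 0, 0])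
        ⟨r, by simp [q]; linear_combination hr, rfl⟩ ?_ ?_ ?_ hg
      · rintro _ ⟨x, hx, rfl⟩
        refine ⟨a - x, ?_, by simp [V1_apply]⟩
        simp [q] at hx ⊢
        linear_combination hx
      · rintro _ ⟨x, hx, rfl⟩
        exact ⟨x, hx, by simp [V2_apply]⟩
      · rintro _ ⟨x, hx, rfl⟩
        exact ⟨x, hx, by simp [V3_apply]⟩
    obtain ⟨x, hx, hgx⟩ := hgw
    have := hmem _ x hq0 hx
    rw [hgx]
    fin_cases i <;> simp [this]
  | typeIII k =>
    have hgw : g ![-1, 0, 0] = ![-1, 0, 0] ∨ g ![-1, 0, 0] = ![-1, k, 0] ∨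
        g ![-1, 0, 0] = ![-1, 0, k] := by
      refine orbit_induction (fun v => v = ![-1, 0, 0] ∨ v = ![-1, k, 0] ∨
        v = ![-1, 0, k]) (.inl rfl) ?_ ?_ ?_ hg <;> rintro _ (rfl | rfl | rfl) <;>
        simp [V1_apply, V2_apply, V3_apply] <;> norm_num
    rcases hgw with h | h | h <;> rw [h] <;> fin_cases i <;> simp
  | typeIV k =>
    have hgw : g ![-1, -1, -1] = ![-1, -1, -1] ∨ g ![-1, -1, -1] = ![k + 2, -1, -1] ∨
        g ![-1, -1, -1] = ![-1, k + 2, -1] ∨ g ![-1, -1, -1] = ![-1, -1, k + 2] := by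
      refine orbit_induction (fun v => v = ![-1, -1, -1] ∨ v = ![k + 2, -1, -1] ∨
        v = ![-1, k + 2, -1] ∨ v = ![-1, -1, k + 2]) (.inl rfl) ?_ ?_ ?_ hg <;>
        rintro _ (rfl | rfl | rfl | rfl) <;>
        simp [V1_apply, V2_apply, V3_apply] <;> ring_nf <;> simp
    rcases hgw with h | h | h | h <;> rw [h] <;> fin_cases i <;> simp
  | exceptional s hs _ _ h =>
    have h1 := h.aeval_eq_zero (hM' s hs) hg i
    have : g w i ∈ rt Mp := by
      refine hmem _ _ hMp0 ?_
      rw [eval_map, ← algebraMap_int_eq, ← aeval_def, h1]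
    simp [this]

/-- The finitely many equivalences move coordinates only up to order and sign. So the union, over
all signed permutations, of the sets for the transformed parameters and their negatives suffices. -/
theorem exists_finset_smallOrbits : ∃ K : ℕ, ∀ p : ℕ, ∀ [Fact p.Prime], p ≠ 2 →
    ∀ P : Params (ZMod p), ∃ R : Finset (ZMod p), R.card ≤ K ∧
      ∀ v ∈ smallOrbits P, ∀ i, v i ∈ R := by
  classical
  obtain ⟨K, hK⟩ := exists_finset_seedOrbits
  refine ⟨Fintype.card (Equiv.Perm (Fin 3) × (Fin 3 → ℤˣ)) * (K + K), fun p _ hp P => ?_⟩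
  choose R hR hR' using fun s : Equiv.Perm (Fin 3) × (Fin 3 → ℤˣ) =>
    hK p hp (P.signedPerm s.1 s.2)
  refine ⟨Finset.univ.biUnion fun s => R s ∪ (R s).image (- ·), ?_, ?_⟩
  · refine Finset.card_biUnion_le_card_mul _ _ _ fun s _ => ?_
    exact (Finset.card_union_le _ _).trans
      (add_le_add (hR s) (Finset.card_image_le.trans (hR s)))
  · rintro v ⟨σ, ε, -, w, hw, g, hg, hgw⟩ i
    have h1 := hR' (σ, ε) w hw g hg (σ.symm i)
    rw [hgw] at h1
    refine Finset.mem_biUnion.2 ⟨(σ, ε), Finset.mem_univ _, ?_⟩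
    simp only [signedPerm, Equiv.apply_symm_apply] at h1
    rw [Finset.mem_union, Finset.mem_image]
    rcases Int.units_eq_one_or (ε (σ.symm i)) with h | h <;> rw [h] at h1
    · left; simpa using h1
    · right; exact ⟨_, h1, by simp⟩

end Markoff

namespace Markoff

/-! ### Powers of a root of X² - xX + 1 in characteristic p -/

section Powers

theorem quadraticChar_cast_eq_pow {p m : ℕ} [Fact p.Prime] (hp : p = 2 * m + 1)
    (a : ZMod p) : ((quadraticChar (ZMod p) a : ℤ) : ZMod p) = a ^ m := by
  rw [quadraticChar_eq_pow_of_char_ne_two' (by rw [ZMod.ringChar_zmod_n]; omega), ZMod.card]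
  congr 1
  omega

theorem two_ne_zero_zmod {p m : ℕ} [Fact p.Prime] (hp : p = 2 * m + 1) (hm : m ≠ 0) :
    (2 : ZMod p) ≠ 0 := by
  intro h
  have : ((2 : ℕ) : ZMod p) = 0 := by exact_mod_cast h
  rw [ZMod.natCast_eq_zero_iff] at this
  have := Nat.le_of_dvd (by norm_num) this
  omega

theorem one_ne_neg_one_zmod {p m : ℕ} [Fact p.Prime] (hp : p = 2 * m + 1) (hm : m ≠ 0) :
    (1 : ZMod p) ≠ -1 := by
  intro h
  exact two_ne_zero_zmod hp hm (by linear_combination h)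

theorem even_iff_quadraticChar_neg_one {p m : ℕ} [Fact p.Prime] (hp : p = 2 * m + 1)
    (hm : m ≠ 0) : Even m ↔ quadraticChar (ZMod p) (-1) = 1 := by
  have h := quadraticChar_cast_eq_pow hp (-1)
  have hne := one_ne_neg_one_zmod hp hm
  constructor
  · intro he
    rw [he.neg_one_pow] at h
    rcases quadraticChar_dichotomy (F := ZMod p) (a := -1) (by simp) with h1 | h1
    · exact h1
    · rw [h1] at h; exact absurd h.symm (by simpa using hne)
  · intro h1
    rw [h1] at h
    by_contra ho
    rw [(Nat.not_even_iff_odd.1 ho).neg_one_pow] at h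
    exact hne (by simpa using h)

variable {p m : ℕ} [Fact p.Prime] {A : Type*} [CommRing A] [Algebra (ZMod p) A] [CharP A p]

/-- From (u + 1)² = (x + 2)u one gets (u + 1)^(p+1) = χ(x + 2)(x + 2)u^(m+1). Since (2u - x)² = x² -
4, Frobenius sends u to u or to x - u according to χ(x² - 4), so the left side is (x + 2)u or x + 2.
The algebra need not be a field, which covers the split and inert cases at once. -/
theorem pow_eq_quadraticChar (hp : p = 2 * m + 1) (hm : m ≠ 0) {x : ZMod p} {u : A}
    (hu : u ^ 2 = algebraMap (ZMod p) A x * u - 1) :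
    (quadraticChar (ZMod p) ((x - 2) * (x + 2)) = 1 →
      u ^ m = algebraMap (ZMod p) A (quadraticChar (ZMod p) (x + 2) : ℤ)) ∧
    (quadraticChar (ZMod p) ((x - 2) * (x + 2)) = -1 →
      u ^ (m + 1) = algebraMap (ZMod p) A (quadraticChar (ZMod p) (x + 2) : ℤ)) := by
  set i := algebraMap (ZMod p) A with hi
  set a := i x with ha
  have hunit : ∀ y : ZMod p, y ≠ 0 → IsUnit (i y) := fun y hy => hy.isUnit.map i
  have hi2 : i 2 = 2 := map_ofNat i 2
  have h2 : IsUnit (2 : A) := by simpa [hi2] using hunit 2 (two_ne_zero_zmod hp hm)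
  have hfrob : ∀ y : ZMod p, i y ^ p = i y := fun y => by rw [← map_pow, ZMod.pow_card]
  have hδ2 : (2 * u - a) ^ 2 = i ((x - 2) * (x + 2)) := by
    simp only [map_mul, map_sub, map_add, map_ofNat, ← ha]
    linear_combination 4 * hu
  have hδp : (2 * u - a) ^ p =
      (2 * u - a) * i (quadraticChar (ZMod p) ((x - 2) * (x + 2)) : ℤ) := by
    rw [quadraticChar_cast_eq_pow hp, map_pow, ← hδ2, ← pow_mul]
    conv_lhs => rw [show p = 1 + 2 * m by omega, pow_add, pow_one]
  have hδp' : (2 * u - a) ^ p = 2 * u ^ p - a := by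
    rw [sub_pow_char, mul_pow, hfrob]
    congr 2
    simpa [hi2] using hfrob 2
  rw [hδp'] at hδp
  set ψ : A := i (quadraticChar (ZMod p) (x + 2) : ℤ) with hψ
  have hsq : (u + 1) ^ 2 = (a + 2) * u := by linear_combination hu
  have hpow : (u + 1) ^ p * (u + 1) = ψ * (a + 2) * u ^ (m + 1) := by
    rw [← pow_succ, show p + 1 = 2 * (m + 1) by omega, pow_mul, hsq, mul_pow, hψ,
      quadraticChar_cast_eq_pow hp, map_pow, map_add, map_ofNat, pow_succ (a + 2)]
  have hfr : (u + 1) ^ p = u ^ p + 1 := by rw [add_pow_char, one_pow]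
  rw [hfr] at hpow
  have hux : u * (a - u) = 1 := by linear_combination -hu
  have aux : quadraticChar (ZMod p) ((x - 2) * (x + 2)) ≠ 0 → IsUnit (a + 2) ∧ ψ * ψ = 1 := by
    intro h
    have hx2 : x + 2 ≠ 0 := by rintro h0; rw [h0] at h; simp at h
    refine ⟨by simpa [hi2] using hunit _ hx2, ?_⟩
    rw [hψ, ← map_mul, ← Int.cast_mul, ← sq, quadraticChar_sq_one hx2]
    simp
  constructor
  · intro h
    obtain ⟨hx2, hψ2⟩ := aux (by rw [h]; norm_num)
    rw [h] at hδp
    have h3 : u ^ p = u := h2.mul_left_cancel (by simp at hδp; linear_combination hδp)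
    rw [h3] at hpow
    have h4 : 1 = ψ * u ^ m := by
      apply hx2.mul_left_cancel
      apply (IsUnit.of_mul_eq_one _ hux).mul_left_cancel
      linear_combination hpow - hsq
    linear_combination (-u ^ m) * hψ2 - ψ * h4
  · intro h
    obtain ⟨hx2, hψ2⟩ := aux (by rw [h]; norm_num)
    rw [h] at hδp
    have h3 : u ^ p = a - u := h2.mul_left_cancel (by simp at hδp; linear_combination hδp)
    rw [h3] at hpow
    have h4 : 1 = ψ * u ^ (m + 1) := by
      apply hx2.mul_left_cancel
      linear_combination hpow + hu
    linear_combination (-u ^ (m + 1)) * hψ2 - ψ * h4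

end Powers

/-! ### Parity of exponents making the companion matrix ±1 -/

section Companion

variable {p m : ℕ} [Fact p.Prime]

/-- The companion matrix of `X² - xX + 1`. -/
def companion {R : Type*} [CommRing R] (x : R) : Matrix (Fin 2) (Fin 2) R := !![0, 1; -1, x]

-- The companion matrix is annihilated by X² - xX + 1, so identities between powers in the quotient
-- ring hold for the matrix.
open Polynomial in
theorem companion_pow_eq {x c : ZMod p} {n : ℕ}
    (h : AdjoinRoot.root (X ^ 2 - C x * X + 1 : (ZMod p)[X]) ^ n =
      algebraMap (ZMod p) (AdjoinRoot (X ^ 2 - C x * X + 1 : (ZMod p)[X])) c) :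
    companion x ^ n = c • 1 := by
  have h1 : AdjoinRoot.mk (X ^ 2 - C x * X + 1 : (ZMod p)[X]) (X ^ n - C c) = 0 := by
    rw [map_sub, map_pow, AdjoinRoot.mk_X, h, AdjoinRoot.mk_C, AdjoinRoot.algebraMap_eq, sub_self]
  obtain ⟨q, hq⟩ := AdjoinRoot.mk_eq_zero.1 h1
  have h2 : aeval (companion x) (X ^ 2 - C x * X + 1 : (ZMod p)[X]) = 0 := by
    simp only [map_add, map_sub, map_mul, map_pow, aeval_X, aeval_C, map_one]
    ext i j
    fin_cases i <;> fin_cases j <;>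
      simp [companion, pow_two, Matrix.mul_apply, Matrix.algebraMap_matrix_apply]
  have h3 := congrArg (aeval (companion x)) hq
  rw [map_mul, h2, zero_mul, map_sub, map_pow, aeval_X, aeval_C, sub_eq_zero,
    Algebra.algebraMap_eq_smul_one] at h3
  exact h3

open Polynomial in
theorem companion_pow (hp : p = 2 * m + 1) (hm : m ≠ 0) (x : ZMod p) :
    (quadraticChar (ZMod p) ((x - 2) * (x + 2)) = 1 →
      companion x ^ m = ((quadraticChar (ZMod p) (x + 2) : ℤ) : ZMod p) • 1) ∧
    (quadraticChar (ZMod p) ((x - 2) * (x + 2)) = -1 →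
      companion x ^ (m + 1) = ((quadraticChar (ZMod p) (x + 2) : ℤ) : ZMod p) • 1) := by
  set f : (ZMod p)[X] := X ^ 2 - C x * X + 1 with hf
  have hmonic : f.Monic := by rw [hf]; monicity!
  have hdeg : f.degree ≠ 0 := by
    have : f.degree = 2 := by rw [hf]; compute_degree!
    rw [this]; norm_num
  have : Nontrivial (AdjoinRoot f) := AdjoinRoot.nontrivial f hdeg
  have : CharP (AdjoinRoot f) p :=
    charP_of_injective_algebraMap (algebraMap (ZMod p) (AdjoinRoot f)).injective p
  have hu : AdjoinRoot.root f ^ 2 = algebraMap (ZMod p) (AdjoinRoot f) x * AdjoinRoot.root f - 1 := by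
    have : AdjoinRoot.mk f (X ^ 2 - C x * X + 1) = 0 := AdjoinRoot.mk_self
    rw [map_add, map_sub, map_mul, map_pow, AdjoinRoot.mk_X, AdjoinRoot.mk_C, map_one] at this
    rw [AdjoinRoot.algebraMap_eq]
    linear_combination this
  have h := pow_eq_quadraticChar hp hm hu
  exact ⟨fun h1 => companion_pow_eq (h.1 h1), fun h1 => companion_pow_eq (h.2 h1)⟩

/-- The usable exponent is m or m + 1 according to χ(x² - 4), and m is even exactly when χ(-1) = 1.
The hypotheses give χ(x² - 4) = -χ(-1), which selects the odd one of the two. -/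
theorem exists_odd_companion_pow (hp : p = 2 * m + 1) (hm : m ≠ 0) {x : ZMod p} {e : ℤ}
    (he : e = 1 ∨ e = -1) (h1 : quadraticChar (ZMod p) (x + 2) = e)
    (h2 : quadraticChar (ZMod p) (x - 2) = -quadraticChar (ZMod p) (-1) * e) :
    ∃ n, Odd n ∧ companion x ^ n = (e : ZMod p) • 1 := by
  have hee : e * e = 1 := by rcases he with rfl | rfl <;> norm_num
  have hc := companion_pow hp hm x
  rw [map_mul, h1, h2, mul_assoc, hee, mul_one] at hc
  have hev := even_iff_quadraticChar_neg_one hp hm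
  rcases quadraticChar_dichotomy (F := ZMod p) (a := -1) (by simp) with h | h
  · exact ⟨m + 1, (hev.2 h).add_one, hc.2 (by rw [h])⟩
  · refine ⟨m, ?_, hc.1 (by rw [h]; norm_num)⟩
    rw [← Nat.not_even_iff_odd, hev, h]
    norm_num

/-- Here χ(x² - 4) = χ(-1), which selects the even exponent among m and m + 1. -/
theorem exists_even_companion_pow (hp : p = 2 * m + 1) (hm : m ≠ 0) {x : ZMod p}
    (h1 : quadraticChar (ZMod p) (x + 2) = -1)
    (h2 : quadraticChar (ZMod p) (x - 2) = -quadraticChar (ZMod p) (-1)) :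
    ∃ n, Even n ∧ companion x ^ n = (-1 : ZMod p) • 1 := by
  have hc := companion_pow hp hm x
  rw [map_mul, h1, h2] at hc
  have hev := even_iff_quadraticChar_neg_one hp hm
  rcases quadraticChar_dichotomy (F := ZMod p) (a := -1) (by simp) with h | h
  · exact ⟨m, hev.2 h, by simpa using hc.1 (by rw [h]; norm_num)⟩
  · refine ⟨m + 1, ?_, by simpa using hc.2 (by rw [h]; norm_num)⟩
    have : ¬ Even m := by rw [hev, h]; norm_num
    exact (Nat.not_even_iff_odd.1 this).add_one

end Companion

end Markoff

namespace Markoff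

/-! ### Γ-orbits under signed permutations, and reduction of Γ' to one automorphism -/

section Rel

variable {R : Type*} [CommRing R] {P : Params R} {u v w : Fin 3 → R}

/-- Two points lie in the same orbit of the Vieta involutions. -/
def Rel (P : Params R) (v w : Fin 3 → R) : Prop := ∃ g ∈ vietaGroup P, g v = w

theorem Rel.refl (P : Params R) (v : Fin 3 → R) : Rel P v v := ⟨1, one_mem _, rfl⟩

theorem Rel.symm (h : Rel P v w) : Rel P w v := by
  obtain ⟨g, hg, rfl⟩ := h
  exact ⟨g⁻¹, inv_mem hg, by simp⟩

theorem Rel.trans (h : Rel P u v) (h' : Rel P v w) : Rel P u w := by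
  obtain ⟨g, hg, rfl⟩ := h
  obtain ⟨g', hg', rfl⟩ := h'
  exact ⟨g' * g, mul_mem hg' hg, rfl⟩

theorem Rel.V1 (P : Params R) (v : Fin 3 → R) : Rel P v (V1 P v) := ⟨_, V1_mem P, rfl⟩

theorem Rel.V2 (P : Params R) (v : Fin 3 → R) : Rel P v (V2 P v) := ⟨_, V2_mem P, rfl⟩

theorem Rel.V3 (P : Params R) (v : Fin 3 → R) : Rel P v (V3 P v) := ⟨_, V3_mem P, rfl⟩

/-- The Vieta involution that changes the coordinate `j`. -/
def vieta (P : Params R) (j : Fin 3) (v : Fin 3 → R) : Fin 3 → R :=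
  Function.update v j (P.coef j + v (j + 1) * v (j + 2) - v j)

theorem V1_eq_vieta (P : Params R) (v : Fin 3 → R) : Markoff.V1 P v = vieta P 0 v := by
  ext i; fin_cases i <;> simp [V1_apply, vieta]

theorem V2_eq_vieta (P : Params R) (v : Fin 3 → R) : Markoff.V2 P v = vieta P 1 v := by
  ext i; fin_cases i <;> simp [V2_apply, vieta, mul_comm]

theorem V3_eq_vieta (P : Params R) (v : Fin 3 → R) : Markoff.V3 P v = vieta P 2 v := by
  ext i; fin_cases i <;> simp [V3_apply, vieta, Function.update]

theorem Rel.vieta (P : Params R) (j : Fin 3) (v : Fin 3 → R) : Rel P v (vieta P j v) := by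
  fin_cases j
  · exact V1_eq_vieta P v ▸ Rel.V1 P v
  · exact V2_eq_vieta P v ▸ Rel.V2 P v
  · exact V3_eq_vieta P v ▸ Rel.V3 P v

theorem perm_three_add : ∀ (σ : Equiv.Perm (Fin 3)) (j : Fin 3),
    (σ (j + 1) = σ j + 1 ∧ σ (j + 2) = σ j + 2) ∨
      (σ (j + 1) = σ j + 2 ∧ σ (j + 2) = σ j + 1) := by decide

theorem sign_three_mul : ∀ (ε : Fin 3 → ℤˣ) (j : Fin 3), ∏ i, ε i = 1 →
    ε j = ε (j + 1) * ε (j + 2) := by decide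

/-- A sign product of 1 means that each sign is the product of the other two, so the product term in
the involution scales like the coordinate it replaces. -/
theorem signedPerm_vieta (P : Params R) (σ : Equiv.Perm (Fin 3)) {ε : Fin 3 → ℤˣ}
    (hε : ∏ i, ε i = 1) (j : Fin 3) (v : Fin 3 → R) :
    signedPerm σ ε (Markoff.vieta P (σ j) v) =
      Markoff.vieta (P.signedPerm σ ε) j (signedPerm σ ε v) := by
  ext k
  by_cases hk : k = j
  · subst hk
    have h1 : (((ε k : ℤ) : R)) = ((ε (k + 1) : ℤ) : R) * ((ε (k + 2) : ℤ) : R) := by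
      rw [sign_three_mul ε k hε]; push_cast; rfl
    simp only [signedPerm, Params.signedPerm, Markoff.vieta, Function.update_self]
    rcases perm_three_add σ k with ⟨h2, h3⟩ | ⟨h2, h3⟩ <;> rw [h2, h3] <;>
      linear_combination (v (σ k + 1) * v (σ k + 2)) * h1
  · have : σ k ≠ σ j := fun h => hk (σ.injective h)
    simp [signedPerm, Markoff.vieta, hk, this]

theorem Rel.signedPerm (h : Rel P v w) (σ : Equiv.Perm (Fin 3)) {ε : Fin 3 → ℤˣ}
    (hε : ∏ i, ε i = 1) :
    Rel (P.signedPerm σ ε) (signedPerm σ ε v) (signedPerm σ ε w) := by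
  obtain ⟨g, hg, rfl⟩ := h
  refine orbit_induction (fun x => Rel (P.signedPerm σ ε) (Markoff.signedPerm σ ε v)
    (Markoff.signedPerm σ ε x)) (Rel.refl _ _) ?_ ?_ ?_ hg
  all_goals
    intro x hx
    refine hx.trans ?_
  · rw [V1_eq_vieta, ← σ.apply_symm_apply 0, signedPerm_vieta P σ hε]; exact Rel.vieta _ _ _
  · rw [V2_eq_vieta, ← σ.apply_symm_apply 1, signedPerm_vieta P σ hε]; exact Rel.vieta _ _ _
  · rw [V3_eq_vieta, ← σ.apply_symm_apply 2, signedPerm_vieta P σ hε]; exact Rel.vieta _ _ _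

theorem signedPerm_signedPerm (σ τ : Equiv.Perm (Fin 3)) (ε η : Fin 3 → ℤˣ) (v : Fin 3 → R) :
    signedPerm τ η (signedPerm σ ε v) = signedPerm (σ * τ) (η * ε ∘ τ) v := by
  ext i
  simp [signedPerm, mul_assoc]

theorem Params.signedPerm_signedPerm (σ τ : Equiv.Perm (Fin 3)) (ε η : Fin 3 → ℤˣ)
    (P : Params R) :
    (P.signedPerm σ ε).signedPerm τ η = P.signedPerm (σ * τ) (η * ε ∘ τ) := by
  simp only [Params.signedPerm, Markoff.signedPerm_signedPerm]

@[simp]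
theorem signedPerm_one_one (v : Fin 3 → R) : signedPerm 1 1 v = v := by
  ext i; simp [signedPerm]

@[simp]
theorem Params.signedPerm_one_one (P : Params R) : P.signedPerm 1 1 = P := by
  simp [Params.signedPerm]

theorem prod_signs_comp {ε η : Fin 3 → ℤˣ} (hε : ∏ i, ε i = 1) (hη : ∏ i, η i = 1)
    (τ : Equiv.Perm (Fin 3)) : ∏ i, (η * ε ∘ τ) i = 1 := by
  simp only [Pi.mul_apply, Function.comp_apply, Finset.prod_mul_distrib, hη, one_mul]
  rw [Equiv.prod_comp τ ε, hε]

/-- The signs that go with `σ⁻¹` in the inverse of `signedPerm σ ε`. -/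
def invSigns (σ : Equiv.Perm (Fin 3)) (ε : Fin 3 → ℤˣ) : Fin 3 → ℤˣ := ε ∘ σ.symm

theorem prod_invSigns (σ : Equiv.Perm (Fin 3)) {ε : Fin 3 → ℤˣ} (hε : ∏ i, ε i = 1) :
    ∏ i, invSigns σ ε i = 1 := by
  simp only [invSigns, Function.comp_apply]
  rw [Equiv.prod_comp σ.symm ε, hε]

theorem invSigns_mul (σ : Equiv.Perm (Fin 3)) (ε : Fin 3 → ℤˣ) :
    invSigns σ ε * ε ∘ (σ⁻¹ : Equiv.Perm (Fin 3)) = 1 := by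
  ext i; simp [invSigns]

theorem mul_invSigns (σ : Equiv.Perm (Fin 3)) (ε : Fin 3 → ℤˣ) :
    ε * invSigns σ ε ∘ σ = 1 := by
  ext i; simp [invSigns]

theorem signedPerm_inv_signedPerm (σ : Equiv.Perm (Fin 3)) (ε : Fin 3 → ℤˣ) (v : Fin 3 → R) :
    signedPerm σ⁻¹ (invSigns σ ε) (signedPerm σ ε v) = v := by
  rw [signedPerm_signedPerm, invSigns_mul, mul_inv_cancel, signedPerm_one_one]

theorem signedPerm_signedPerm_inv (σ : Equiv.Perm (Fin 3)) (ε : Fin 3 → ℤˣ) (v : Fin 3 → R) :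
    signedPerm σ ε (signedPerm σ⁻¹ (invSigns σ ε) v) = v := by
  rw [signedPerm_signedPerm, mul_invSigns, inv_mul_cancel, signedPerm_one_one]

theorem Params.signedPerm_inv_signedPerm (σ : Equiv.Perm (Fin 3)) (ε : Fin 3 → ℤˣ)
    (P : Params R) : (P.signedPerm σ ε).signedPerm σ⁻¹ (invSigns σ ε) = P := by
  simp only [Params.signedPerm, Markoff.signedPerm_inv_signedPerm]

theorem signedPerm_mem_surface (σ : Equiv.Perm (Fin 3)) {ε : Fin 3 → ℤˣ} (hε : ∏ i, ε i = 1)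
    (hv : v ∈ surface P) : signedPerm σ ε v ∈ surface (P.signedPerm σ ε) := by
  have hsum : ∀ f : Fin 3 → R, f 0 + f 1 + f 2 = f (σ 0) + f (σ 1) + f (σ 2) := by
    intro f
    have := Equiv.sum_comp σ f
    simpa [Fin.sum_univ_three] using this.symm
  have hprod : v 0 * v 1 * v 2 = v (σ 0) * v (σ 1) * v (σ 2) := by
    have := Equiv.prod_comp σ v
    simpa [Fin.prod_univ_three] using this.symm
  have hsq : ∀ i, ((ε i : ℤ) : R) * ((ε i : ℤ) : R) = 1 := by
    intro i
    rcases Int.units_eq_one_or (ε i) with h | h <;> simp [h]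
  have he : ((ε 0 : ℤ) : R) * ((ε 1 : ℤ) : R) * ((ε 2 : ℤ) : R) = 1 := by
    rw [Fin.prod_univ_three] at hε
    have := congrArg (fun x : ℤˣ => ((x : ℤ) : R)) hε
    simpa using this
  have h1 := hsum (fun i => v i ^ 2)
  have h2 := hsum (fun i => P.coef i * v i)
  simp only [surface, Set.mem_ofPred_eq, Params.A, Params.B, Params.C, Params.signedPerm,
    Markoff.signedPerm] at hv h1 h2 ⊢
  linear_combination hv - h1 + h2 + hprod - (v (σ 0) * v (σ 1) * v (σ 2)) * he +
    (v (σ 0) ^ 2 - P.coef (σ 0) * v (σ 0)) * hsq 0 +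
    (v (σ 1) ^ 2 - P.coef (σ 1) * v (σ 1)) * hsq 1 +
    (v (σ 2) ^ 2 - P.coef (σ 2) * v (σ 2)) * hsq 2

theorem mem_smallOrbits_of_signedPerm (σ : Equiv.Perm (Fin 3)) {ε : Fin 3 → ℤˣ}
    (hε : ∏ i, ε i = 1) (hv : signedPerm σ ε v ∈ smallOrbits (P.signedPerm σ ε)) :
    v ∈ smallOrbits P := by
  obtain ⟨τ, η, hη, w, hw, g, hg, hgw⟩ := hv
  rw [Params.signedPerm_signedPerm] at hw hg
  rw [signedPerm_signedPerm] at hgw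
  exact ⟨σ * τ, η * ε ∘ τ, prod_signs_comp hε hη τ, w, hw, g, hg, hgw⟩

theorem signedPerm_mem_surfaceStar (σ : Equiv.Perm (Fin 3)) {ε : Fin 3 → ℤˣ}
    (hε : ∏ i, ε i = 1) (hv : v ∈ surfaceStar P) :
    signedPerm σ ε v ∈ surfaceStar (P.signedPerm σ ε) :=
  ⟨signedPerm_mem_surface σ hε hv.1, fun h => hv.2 (mem_smallOrbits_of_signedPerm σ hε h)⟩

/-- `(σ, ε)` is an automorphism of the parameters. -/
def IsAut (P : Params R) (σ : Equiv.Perm (Fin 3)) (ε : Fin 3 → ℤˣ) : Prop :=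
  ∏ i, ε i = 1 ∧ P.signedPerm σ ε = P

theorem Rel.aut {σ : Equiv.Perm (Fin 3)} {ε : Fin 3 → ℤˣ} (hσ : IsAut P σ ε) (h : Rel P v w) :
    Rel P (Markoff.signedPerm σ ε v) (Markoff.signedPerm σ ε w) := by
  have := h.signedPerm σ hσ.1
  rwa [hσ.2] at this

theorem IsAut.mul {σ τ : Equiv.Perm (Fin 3)} {ε η : Fin 3 → ℤˣ} (hσ : IsAut P σ ε)
    (hτ : IsAut P τ η) : IsAut P (σ * τ) (η * ε ∘ τ) :=
  ⟨prod_signs_comp hσ.1 hτ.1 τ, by rw [← Params.signedPerm_signedPerm, hσ.2, hτ.2]⟩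

/-- Two points are related by Vieta involutions and one automorphism of the parameters. -/
def RelFull (P : Params R) (v w : Fin 3 → R) : Prop :=
  ∃ σ ε, IsAut P σ ε ∧ Rel P (signedPerm σ ε v) w

theorem negXY_apply (v : Fin 3 → R) : negXY v = ![-v 0, -v 1, v 2] := rfl

theorem negXZ_apply (v : Fin 3 → R) : negXZ v = ![-v 0, v 1, -v 2] := rfl

theorem negYZ_apply (v : Fin 3 → R) : negYZ v = ![v 0, -v 1, -v 2] := rfl

theorem tauXY_apply {S : Type*} (v : Fin 3 → S) : tauXY v = ![v 1, v 0, v 2] := rfl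

theorem tauXZ_apply {S : Type*} (v : Fin 3 → S) : tauXZ v = ![v 2, v 1, v 0] := rfl

theorem tauYZ_apply {S : Type*} (v : Fin 3 → S) : tauYZ v = ![v 0, v 2, v 1] := rfl

theorem isAut_of_isExtraAut {g : Equiv.Perm (Fin 3 → R)} (hg : IsExtraAut P g) :
    ∃ σ ε, IsAut P σ ε ∧ ∀ v, g v = signedPerm σ ε v := by
  have key : ∀ (σ : Equiv.Perm (Fin 3)) (ε : Fin 3 → ℤˣ), ∏ i, ε i = 1 →
      (∀ i, ((ε i : ℤ) : R) * P.coef (σ i) = P.coef i) → IsAut P σ ε := fun σ ε h h' =>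
    ⟨h, by cases P; simpa [Params.signedPerm, funext_iff, signedPerm] using h'⟩
  cases hg with
  | negXY hA hB =>
    refine ⟨1, ![-1, -1, 1], key _ _ (by decide) ?_, ?_⟩
    · intro i; fin_cases i <;> simp [hA, hB]
    · intro v; ext i; fin_cases i <;> simp [negXY_apply, signedPerm]
  | negXZ hA hB =>
    refine ⟨1, ![-1, 1, -1], key _ _ (by decide) ?_, ?_⟩
    · intro i; fin_cases i <;> simp [hA, hB]
    · intro v; ext i; fin_cases i <;> simp [negXZ_apply, signedPerm]
  | negYZ hA hB =>
    refine ⟨1, ![1, -1, -1], key _ _ (by decide) ?_, ?_⟩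
    · intro i; fin_cases i <;> simp [hA, hB]
    · intro v; ext i; fin_cases i <;> simp [negYZ_apply, signedPerm]
  | tauXY h =>
    refine ⟨Equiv.swap 0 1, 1, key _ _ (by decide) ?_, ?_⟩
    · intro i; fin_cases i <;> simp [h, Equiv.swap_apply_def]
    · intro v; ext i; fin_cases i <;> simp [tauXY_apply, signedPerm, Equiv.swap_apply_def]
  | tauXZ h =>
    refine ⟨Equiv.swap 0 2, 1, key _ _ (by decide) ?_, ?_⟩
    · intro i; fin_cases i <;> simp [h, Equiv.swap_apply_def]
    · intro v; ext i; fin_cases i <;> simp [tauXZ_apply, signedPerm, Equiv.swap_apply_def]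
  | tauYZ h =>
    refine ⟨Equiv.swap 1 2, 1, key _ _ (by decide) ?_, ?_⟩
    · intro i; fin_cases i <;> simp [h, Equiv.swap_apply_def]
    · intro v; ext i; fin_cases i <;> simp [tauYZ_apply, signedPerm, Equiv.swap_apply_def]
  | negTauXY h =>
    refine ⟨Equiv.swap 0 1, ![-1, -1, 1], key _ _ (by decide) ?_, ?_⟩
    · intro i; fin_cases i <;> simp [h, Equiv.swap_apply_def]
    · intro v; ext i; fin_cases i <;> simp [negXY_apply, tauXY_apply, signedPerm, Equiv.swap_apply_def]
  | negTauXZ h =>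
    refine ⟨Equiv.swap 0 2, ![-1, 1, -1], key _ _ (by decide) ?_, ?_⟩
    · intro i; fin_cases i <;> simp [h, Equiv.swap_apply_def]
    · intro v; ext i; fin_cases i <;> simp [negXZ_apply, tauXZ_apply, signedPerm, Equiv.swap_apply_def]
  | negTauYZ h =>
    refine ⟨Equiv.swap 1 2, ![1, -1, -1], key _ _ (by decide) ?_, ?_⟩
    · intro i; fin_cases i <;> simp [h, Equiv.swap_apply_def]
    · intro v; ext i; fin_cases i <;> simp [negYZ_apply, tauYZ_apply, signedPerm, Equiv.swap_apply_def]

theorem IsAut.one (P : Params R) : IsAut P 1 1 := ⟨by simp, by simp⟩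

/-- Automorphisms of the parameters normalise Γ, so in a word all of them can be moved to the front
and multiplied into one. -/
theorem relFull_of_mem_fullGroup {g : Equiv.Perm (Fin 3 → R)} (hg : g ∈ fullGroup P)
    (v : Fin 3 → R) : RelFull P v (g v) := by
  have hstep : ∀ x ∈ ({V1 P, V2 P, V3 P} ∪ {g | IsExtraAut P g} : Set (Equiv.Perm (Fin 3 → R))),
      ∀ w, RelFull P v w → RelFull P v (x w) := by
    rintro x ((rfl | rfl | rfl) | hx) w ⟨σ, ε, hσ, h⟩
    · exact ⟨σ, ε, hσ, h.trans (Rel.V1 _ _)⟩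
    · exact ⟨σ, ε, hσ, h.trans (Rel.V2 _ _)⟩
    · exact ⟨σ, ε, hσ, h.trans (Rel.V3 _ _)⟩
    · obtain ⟨τ, η, hτ, hx⟩ := isAut_of_isExtraAut hx
      refine ⟨σ * τ, η * ε ∘ τ, hσ.mul hτ, ?_⟩
      rw [← signedPerm_signedPerm, hx]
      exact h.aut hτ
  have hinv : ∀ x ∈ ({V1 P, V2 P, V3 P} ∪ {g | IsExtraAut P g} : Set (Equiv.Perm (Fin 3 → R))),
      ∀ w, RelFull P v w → RelFull P v (x⁻¹ w) := by
    rintro x ((rfl | rfl | rfl) | hx) w hw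
    · exact hstep _ (by simp [V1_inv]) w hw
    · exact hstep _ (by simp [V2_inv]) w hw
    · exact hstep _ (by simp [V3_inv]) w hw
    · obtain ⟨σ, ε, hσ, h⟩ := hw
      obtain ⟨τ, η, hτ, hx⟩ := isAut_of_isExtraAut hx
      have hτ' : IsAut P τ⁻¹ (invSigns τ η) := by
        refine ⟨prod_invSigns τ hτ.1, ?_⟩
        have := Params.signedPerm_inv_signedPerm τ η P
        rwa [hτ.2] at this
      refine ⟨σ * τ⁻¹, invSigns τ η * ε ∘ (τ⁻¹ : Equiv.Perm (Fin 3)), hσ.mul hτ', ?_⟩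
      have hxw : x⁻¹ w = signedPerm τ⁻¹ (invSigns τ η) w := by
        rw [Equiv.Perm.inv_eq_iff_eq, hx, signedPerm_signedPerm_inv]
      rw [← signedPerm_signedPerm, hxw]
      exact h.aut hτ'
  refine Subgroup.closure_induction_left (p := fun g _ => RelFull P v (g v)) ?_ ?_ ?_ hg
  · exact ⟨1, 1, IsAut.one P, by simpa using Rel.refl P v⟩
  · exact fun x hx y _ hy => hstep x hx _ hy
  · exact fun x hx y _ hy => hinv x hx _ hy

end Rel

end Markoff

namespace Markoff

/-! ### The rotation on a slice of constant x -/

section Slices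

variable {R : Type*} [CommRing R] {P : Params R} {u v w : Fin 3 → R}

theorem signedPerm_swap_apply (e : ℤˣ) (v : Fin 3 → R) :
    signedPerm (Equiv.swap 1 2) ![1, e, e] v =
      ![v 0, ((e : ℤ) : R) * v 2, ((e : ℤ) : R) * v 1] := by
  ext i; fin_cases i <;> simp [signedPerm, Equiv.swap_apply_def]

theorem signedPerm_one_apply (e : ℤˣ) (v : Fin 3 → R) :
    signedPerm 1 ![1, e, e] v = ![v 0, ((e : ℤ) : R) * v 1, ((e : ℤ) : R) * v 2] := by
  ext i; fin_cases i <;> simp [signedPerm]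

theorem prod_signs_diag (e : ℤˣ) : ∏ i, (![1, e, e] : Fin 3 → ℤˣ) i = 1 := by
  revert e; decide

/-- The rotation `τ_yz ∘ V₂`. -/
def rotation (P : Params R) (v : Fin 3 → R) : Fin 3 → R := ![v 0, v 2, P.B + v 0 * v 2 - v 1]

theorem rel_swap (hBC : P.B = P.C) (h : Rel P v w) : Rel P ![v 0, v 2, v 1] ![w 0, w 2, w 1] := by
  have hP : IsAut P (Equiv.swap 1 2) ![1, 1, 1] := by
    refine ⟨prod_signs_diag 1, ?_⟩
    cases P
    simp only [Params.signedPerm, signedPerm_swap_apply, Params.mk.injEq, and_true]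
    simp only [Params.B, Params.C] at hBC
    ext i; fin_cases i <;> simp [hBC]
  have := h.aut hP
  simpa [signedPerm_swap_apply] using this

theorem rel_rotation (hBC : P.B = P.C) (v : Fin 3 → R) :
    Rel P (rotation P v) ![v 0, v 2, v 1] := by
  have := (rel_swap hBC (Rel.V2 P v)).symm
  simpa [V2_apply, rotation] using this

/-- Up to Γ the rotation is the transposition τ_yz, which normalises Γ, so only the parity of `n`
matters. -/
theorem rel_rotation_iterate (hBC : P.B = P.C) (v : Fin 3 → R) (n : ℕ) :
    (Even n → Rel P ((rotation P)^[n] v) v) ∧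
      (Odd n → Rel P ((rotation P)^[n] v) ![v 0, v 2, v 1]) := by
  induction n with
  | zero => exact ⟨fun _ => Rel.refl _ _, fun h => absurd h (by decide)⟩
  | succ n ih =>
    rw [Function.iterate_succ_apply']
    have h := rel_rotation hBC ((rotation P)^[n] v)
    constructor
    · intro hn
      have := rel_swap hBC (ih.2 (by rwa [Nat.even_add_one, Nat.not_even_iff_odd] at hn))
      refine (h.trans this).trans ?_
      have e : ![(![v 0, v 2, v 1] : Fin 3 → R) 0, (![v 0, v 2, v 1] : Fin 3 → R) 2,
        (![v 0, v 2, v 1] : Fin 3 → R) 1] = v := by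
        ext i; fin_cases i <;> simp
      rw [e]
      exact Rel.refl _ _
    · intro hn
      exact h.trans (rel_swap hBC (ih.1 (by rwa [Nat.odd_add_one, Nat.not_odd_iff_even] at hn)))

/-- `γ` is the constant solution of the recursion y'' = B + xy' - y; subtracting it makes the
recursion linear. -/
theorem rotation_iterate (v : Fin 3 → R) {γ : R} (hγ : γ * (2 - v 0) = P.B) (n : ℕ) :
    (rotation P)^[n] v = ![v 0, γ + (companion (v 0) ^ n).mulVec ![v 1 - γ, v 2 - γ] 0,
      γ + (companion (v 0) ^ n).mulVec ![v 1 - γ, v 2 - γ] 1] := by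
  induction n with
  | zero => ext i; fin_cases i <;> simp
  | succ n ih =>
    rw [Function.iterate_succ_apply', ih, pow_succ', ← Matrix.mulVec_mulVec]
    set w := (companion (v 0) ^ n).mulVec ![v 1 - γ, v 2 - γ]
    ext i
    fin_cases i
    · simp [rotation]
    · simp [rotation, companion, Matrix.mulVec, dotProduct, Fin.sum_univ_two]
    · simp [rotation, companion, Matrix.mulVec, dotProduct, Fin.sum_univ_two, ← hγ]
      ring

theorem rotation_iterate_of_companion_pow (v : Fin 3 → R) {γ c : R} (hγ : γ * (2 - v 0) = P.B)
    {n : ℕ} (hn : companion (v 0) ^ n = c • 1) :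
    (rotation P)^[n] v = ![v 0, γ + c * (v 1 - γ), γ + c * (v 2 - γ)] := by
  rw [rotation_iterate v hγ, hn]
  ext i; fin_cases i <;> simp [Matrix.smul_mulVec]

/-- At x = 2 a constant solution need not exist. The recursion has constant second difference B, and
doubling avoids the denominator of n(n - 1)/2. -/
theorem rotation_iterate_two (v : Fin 3 → R) (hv : v 0 = 2) (n : ℕ) :
    ((rotation P)^[n] v) 0 = 2 ∧
    2 * ((rotation P)^[n] v) 1 = 2 * v 1 + n * (2 * (v 2 - v 1) + P.B * (n - 1)) ∧
    2 * ((rotation P)^[n] v) 2 = 2 * v 2 + n * (2 * (v 2 - v 1) + P.B * (n + 1)) := by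
  induction n with
  | zero => simp [hv]
  | succ n ih =>
    obtain ⟨h0, h1, h2⟩ := ih
    rw [Function.iterate_succ_apply']
    simp only [rotation, Matrix.cons_val_zero, Matrix.cons_val_one, Matrix.cons_val]
    refine ⟨h0, ?_, ?_⟩
    · push_cast; linear_combination h2
    · rw [h0]; push_cast; linear_combination 2 * h2 - h1

end Slices

/-! ### Slices on which Γ realises swaps and sign changes -/

section FiniteField

variable {p m : ℕ} [Fact p.Prime] {P : Params (ZMod p)} {v : Fin 3 → ZMod p}

/-- The p-th iterate of the rotation is trivial here, and p is odd. -/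
theorem rel_swap_of_eq_two (hp : p = 2 * m + 1) (hm : m ≠ 0) (hBC : P.B = P.C) (hv : v 0 = 2) :
    Rel P v ![v 0, v 2, v 1] := by
  have h := (rel_rotation_iterate hBC v p).2 ⟨m, hp⟩
  obtain ⟨h0, h1, h2⟩ := rotation_iterate_two (P := P) v hv p
  have h2' := two_ne_zero_zmod hp hm
  simp only [CharP.cast_eq_zero, zero_mul, add_zero] at h1 h2
  have e : (rotation P)^[p] v = v := by
    ext i
    fin_cases i
    · exact h0.trans hv.symm
    · exact mul_left_cancel₀ h2' h1
    · exact mul_left_cancel₀ h2' h2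
  rwa [e] at h

/-- `x = ω + ω⁻¹` with `ω` of odd order. -/
def IsOddType (x : ZMod p) : Prop :=
  quadraticChar (ZMod p) (x + 2) = 1 ∧
    quadraticChar (ZMod p) (x - 2) = -quadraticChar (ZMod p) (-1)

theorem IsOddType.sub_two_ne_zero {x : ZMod p} (h : IsOddType x) : x - 2 ≠ 0 := by
  intro h0
  have := h.2
  rw [h0, quadraticChar_zero] at this
  rcases quadraticChar_dichotomy (F := ZMod p) (a := -1) (by simp) with h1 | h1 <;>
    rw [h1] at this <;> norm_num at this

theorem rel_swap_of_isOddType (hp : p = 2 * m + 1) (hm : m ≠ 0) (hBC : P.B = P.C)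
    (hv : IsOddType (v 0)) : Rel P v ![v 0, v 2, v 1] := by
  obtain ⟨n, hn, hc⟩ := exists_odd_companion_pow hp hm (.inl rfl) hv.1 (by simpa using hv.2)
  have h := (rel_rotation_iterate hBC v n).2 hn
  have h2 : 2 - v 0 ≠ 0 := fun h0 => hv.sub_two_ne_zero (by linear_combination -h0)
  rw [rotation_iterate_of_companion_pow (γ := P.B / (2 - v 0)) v (div_mul_cancel₀ _ h2) hc] at h
  have e : v = ![v 0, P.B / (2 - v 0) + ((1 : ℤ) : ZMod p) * (v 1 - P.B / (2 - v 0)),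
      P.B / (2 - v 0) + ((1 : ℤ) : ZMod p) * (v 2 - P.B / (2 - v 0))] := by
    ext i; fin_cases i <;> simp
  rwa [← e] at h

/-- With B = C = 0 an odd iterate multiplies (y, z) by `e`, while up to Γ it swaps them. -/
theorem rel_signed_swap (hp : p = 2 * m + 1) (hm : m ≠ 0) (hB : P.B = 0) (hC : P.C = 0)
    {e : ℤˣ} (h1 : quadraticChar (ZMod p) (v 0 + 2) = e)
    (h2 : quadraticChar (ZMod p) (v 0 - 2) = -quadraticChar (ZMod p) (-1) * e) :
    Rel P v (signedPerm (Equiv.swap 1 2) ![1, e, e] v) := by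
  obtain ⟨n, hn, hc⟩ := exists_odd_companion_pow hp hm
    (by rcases Int.units_eq_one_or e with rfl | rfl <;> simp) h1 h2
  have h := (rel_rotation_iterate (hB.trans hC.symm) v n).2 hn
  rw [rotation_iterate_of_companion_pow (γ := 0) v (by simp [hB]) hc] at h
  have hP : IsAut P 1 ![1, e, e] := by
    refine ⟨prod_signs_diag e, ?_⟩
    cases P
    simp only [Params.signedPerm, signedPerm_one_apply, Params.mk.injEq, and_true]
    simp only [Params.B, Params.C] at hB hC
    ext i; fin_cases i <;> simp [hB, hC]
  have h3 := h.aut hP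
  rw [signedPerm_one_apply, signedPerm_one_apply] at h3
  rw [signedPerm_swap_apply]
  rcases Int.units_eq_one_or e with rfl | rfl
  · convert! h3 using 1
    ext i; fin_cases i <;> simp
  · convert! h3 using 1
    ext i; fin_cases i <;> simp

theorem rel_neg (hp : p = 2 * m + 1) (hm : m ≠ 0) (hB : P.B = 0) (hC : P.C = 0)
    (h1 : quadraticChar (ZMod p) (v 0 + 2) = -1)
    (h2 : quadraticChar (ZMod p) (v 0 - 2) = -quadraticChar (ZMod p) (-1)) :
    Rel P v (signedPerm 1 ![1, -1, -1] v) := by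
  obtain ⟨n, hn, hc⟩ := exists_even_companion_pow hp hm h1 h2
  have h := (rel_rotation_iterate (hB.trans hC.symm) v n).1 hn
  rw [rotation_iterate_of_companion_pow (γ := 0) v (by simp [hB]) hc] at h
  rw [signedPerm_one_apply]
  convert! h.symm using 1
  ext i; fin_cases i <;> simp

end FiniteField

end Markoff

namespace Markoff

/-! ### Composing automorphisms that preserve an orbit -/

section Automorphisms

variable {R : Type*} [CommRing R] {P : Params R} {u v w : Fin 3 → R}

theorem IsAut.coef_eq {σ : Equiv.Perm (Fin 3)} {ε : Fin 3 → ℤˣ} (h : IsAut P σ ε) (i : Fin 3) :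
    ((ε i : ℤ) : R) * P.coef (σ i) = P.coef i :=
  congrFun (congrArg Params.coef h.2) i

theorem isAut_of_coef_eq {σ : Equiv.Perm (Fin 3)} {ε : Fin 3 → ℤˣ} (h : ∏ i, ε i = 1)
    (h' : ∀ i, ((ε i : ℤ) : R) * P.coef (σ i) = P.coef i) : IsAut P σ ε :=
  ⟨h, by cases P; simpa [Params.signedPerm, funext_iff, signedPerm] using h'⟩

theorem Rel.mul {σ τ : Equiv.Perm (Fin 3)} {ε η : Fin 3 → ℤˣ}
    (hσ : Rel P v (Markoff.signedPerm σ ε v)) (hτ : IsAut P τ η)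
    (hτ' : Rel P v (Markoff.signedPerm τ η v)) :
    Rel P v (Markoff.signedPerm (σ * τ) (η * ε ∘ τ) v) := by
  rw [← signedPerm_signedPerm]
  exact hτ'.trans (hσ.aut hτ)

/-- Carries a sign change realised at `v` to any point of its Γ'-orbit; conjugation by the
connecting automorphism only permutes the signs. -/
theorem Rel.conj {σ : Equiv.Perm (Fin 3)} {ε η : Fin 3 → ℤˣ}
    (hv : Rel P v (Markoff.signedPerm 1 η v)) (hσ : IsAut P σ ε)
    (hw : Rel P (Markoff.signedPerm σ ε v) w) (hη : IsAut P 1 (η ∘ σ)) :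
    Rel P w (Markoff.signedPerm 1 (η ∘ σ) w) := by
  refine (hw.symm.trans (hv.aut hσ)).trans ?_
  have h1 := hw.aut hη
  rw [signedPerm_signedPerm] at h1 ⊢
  convert! h1 using 2
  ext i
  simp [mul_comm]

theorem perm_three_cases : ∀ σ : Equiv.Perm (Fin 3),
    (σ 0 = 0 ∧ σ 1 = 1 ∧ σ 2 = 2) ∨ (σ 0 = 1 ∧ σ 1 = 0 ∧ σ 2 = 2) ∨
    (σ 0 = 2 ∧ σ 1 = 1 ∧ σ 2 = 0) ∨ (σ 0 = 0 ∧ σ 1 = 2 ∧ σ 2 = 1) ∨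
    (σ 0 = 1 ∧ σ 1 = 2 ∧ σ 2 = 0) ∨ (σ 0 = 2 ∧ σ 1 = 0 ∧ σ 2 = 1) := by decide

theorem sign_three_cases : ∀ ε : Fin 3 → ℤˣ, ∏ i, ε i = 1 →
    ε = ![1, 1, 1] ∨ ε = ![1, -1, -1] ∨ ε = ![-1, 1, -1] ∨ ε = ![-1, -1, 1] := by decide

theorem perm_three_fix_zero : ∀ σ : Equiv.Perm (Fin 3), σ 0 = 0 →
    σ = 1 ∨ σ = Equiv.swap 1 2 := by decide

theorem perm_three_words : ∀ σ : Equiv.Perm (Fin 3), σ = 1 ∨ σ = Equiv.swap 1 2 ∨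
    σ = Equiv.swap 0 2 ∨ σ = Equiv.swap 1 2 * Equiv.swap 0 2 ∨
    σ = Equiv.swap 0 2 * Equiv.swap 1 2 ∨
    σ = Equiv.swap 1 2 * Equiv.swap 0 2 * Equiv.swap 1 2 := by decide

theorem rel_perm_of_swaps (hP : ∀ σ, IsAut P σ 1)
    (h12 : Rel P v (signedPerm (Equiv.swap 1 2) 1 v))
    (h02 : Rel P v (signedPerm (Equiv.swap 0 2) 1 v)) (σ : Equiv.Perm (Fin 3)) :
    Rel P v (signedPerm σ 1 v) := by
  have hmul : ∀ σ τ, Rel P v (signedPerm σ 1 v) → Rel P v (signedPerm τ 1 v) →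
      Rel P v (signedPerm (σ * τ) 1 v) := fun σ τ hσ hτ => by
    have := hσ.mul (hP τ) hτ
    simpa using this
  rcases perm_three_words σ with rfl | rfl | rfl | rfl | rfl | rfl
  · simpa using Rel.refl P v
  · exact h12
  · exact h02
  · exact hmul _ _ h12 h02
  · exact hmul _ _ h02 h12
  · exact hmul _ _ (hmul _ _ h12 h02) h12

end Automorphisms

/-- All automorphisms of the parameters preserve the orbit of `v`. -/
def IsStable {R : Type*} [CommRing R] (P : Params R) (v : Fin 3 → R) : Prop :=
  ∀ σ ε, IsAut P σ ε → Rel P v (signedPerm σ ε v)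

/-! ### Constructing points; parameters (c, a, a) with c ≠ ±a -/

section Points

variable {p m K : ℕ} [Fact p.Prime] {P : Params (ZMod p)}

theorem isSquare_of_quadraticChar {a : ZMod p} (h : quadraticChar (ZMod p) a = 1) : IsSquare a := by
  have : a ≠ 0 := by rintro rfl; simp at h
  exact (quadraticChar_one_iff_isSquare this).1 h

/-- The left side of `h` is the discriminant of the surface equation as a quadratic in z. One
coordinate outside `R` keeps the point off the small orbits. -/
theorem exists_mem_surfaceStar (h2 : (2 : ZMod p) ≠ 0) {a b c d : ZMod p} {R : Finset (ZMod p)}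
    (hE : ∀ v ∈ smallOrbits ⟨![a, b, c], d⟩, ∀ i, v i ∈ R) {x y s : ZMod p} (hy : y ∉ R)
    (hs : IsSquare s)
    (h : (x * y + c) ^ 2 - 4 * (x ^ 2 + y ^ 2 - a * x - b * y - d) = s) :
    ∃ z, ![x, y, z] ∈ surfaceStar ⟨![a, b, c], d⟩ := by
  obtain ⟨t, rfl⟩ := hs
  refine ⟨(x * y + c + t) / 2, ?_, fun hs => hy (by simpa using hE _ hs 1)⟩
  simp only [surface, Set.mem_ofPred_eq, Matrix.cons_val_zero, Matrix.cons_val_one,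
    Matrix.cons_val, Params.A_mk, Params.B_mk, Params.C_mk]
  have h4 : (4 : ZMod p) ≠ 0 := by
    have := mul_ne_zero h2 h2
    norm_num at this
    exact this
  field_simp
  apply mul_left_cancel₀ h4
  linear_combination -4 * h

theorem quadraticChar_sign {a : ZMod p} (h : a ≠ 0) :
    quadraticChar (ZMod p) a = 1 ∨ quadraticChar (ZMod p) a = -1 := quadraticChar_dichotomy h

theorem neg_quadraticChar_sign {a : ZMod p} (h : a ≠ 0) :
    -quadraticChar (ZMod p) a = 1 ∨ -quadraticChar (ZMod p) a = -1 := by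
  rcases quadraticChar_dichotomy h with h | h <;> simp [h]

theorem quadraticChar_mul_self {a : ZMod p} (h : a ≠ 0) :
    quadraticChar (ZMod p) a * quadraticChar (ZMod p) a = 1 := by
  rcases quadraticChar_dichotomy h with h | h <;> simp [h]

theorem isAut_diag {c d : ZMod p} (e : ℤˣ) :
    IsAut (⟨![c, 0, 0], d⟩ : Params (ZMod p)) 1 ![1, e, e] :=
  isAut_of_coef_eq (prod_signs_diag e) (by intro i; fin_cases i <;> simp)

/-- Only the transposition of the last two coordinates is applicable. -/
theorem exists_isStable_of_ne (hp : p = 2 * m + 1) (hm : m ≠ 0) (hK : 32 * K + 200 ≤ p)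
    {R : Finset (ZMod p)} (hR : R.card ≤ K) {a c d : ZMod p} (ha : a ≠ 0) (hc : c ≠ a)
    (hc' : c ≠ -a) (hE : ∀ v ∈ smallOrbits ⟨![c, a, a], d⟩, ∀ i, v i ∈ R) :
    ∃ v ∈ surfaceStar ⟨![c, a, a], d⟩, IsStable ⟨![c, a, a], d⟩ v := by
  have h2 := two_ne_zero_zmod hp hm
  have h8 : 8 * a ≠ 0 := by
    have := mul_ne_zero (mul_ne_zero (mul_ne_zero h2 h2) h2) ha
    convert! this using 2; norm_num
  -- At x = 2 the discriminant is linear in y, namely 8a(y - ρ).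
  set ρ := -(a ^ 2 - 16 + 8 * c + 4 * d) / (8 * a) with hρ
  have hρ' : 8 * a * ρ = -(a ^ 2 - 16 + 8 * c + 4 * d) := mul_div_cancel₀ _ h8
  -- Only the condition at ρ matters; the other two points are fillers.
  obtain ⟨y, hyR, hy, -, -⟩ := exists_quadraticChar_eq hK R hR (a := ρ) (b := ρ + 1) (c := ρ + 2)
    (by simp) (by simpa using h2) (fun h => one_ne_zero (α := ZMod p) (by linear_combination -h))
    (quadraticChar_sign h8) (t := 1) (u := 1) (.inl rfl) (.inl rfl)
  obtain ⟨z, hz⟩ := exists_mem_surfaceStar (x := 2) h2 hE hyR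
    (isSquare_of_quadraticChar (a := 8 * a * (y - ρ))
      (by rw [map_mul, hy, quadraticChar_mul_self h8]))
    (by linear_combination hρ')
  refine ⟨_, hz, fun σ ε h => ?_⟩
  have hsw : Rel (⟨![c, a, a], d⟩ : Params (ZMod p)) ![2, y, z] ![2, z, y] := by
    simpa using rel_swap_of_eq_two (P := ⟨![c, a, a], d⟩) (v := ![2, y, z]) hp hm rfl rfl
  have e0 := h.coef_eq 0
  have e1 := h.coef_eq 1
  have e2 := h.coef_eq 2
  have hsign : ∀ e : ℤˣ, ((e : ℤ) : ZMod p) * a = a → e = 1 := by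
    intro e he
    rcases Int.units_eq_one_or e with rfl | rfl
    · rfl
    · exfalso; apply mul_ne_zero h2 ha; simp at he; linear_combination -he
  have hc0 : ∀ e : ℤˣ, ((e : ℤ) : ZMod p) * a ≠ c := by
    intro e he
    rcases Int.units_eq_one_or e with rfl | rfl
    · exact hc (by simpa using he.symm)
    · exact hc' (by simpa using he.symm)
  -- As c ≠ ±a, an automorphism fixes the first position; as a ≠ 0, it has no signs. Only the
  -- identity and τ_yz survive.
  rcases perm_three_cases σ with ⟨s0, s1, s2⟩ | ⟨s0, s1, s2⟩ | ⟨s0, s1, s2⟩ | ⟨s0, s1, s2⟩ |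
    ⟨s0, s1, s2⟩ | ⟨s0, s1, s2⟩ <;> simp only [s0, s1, s2, Matrix.cons_val_zero,
      Matrix.cons_val_one, Matrix.cons_val] at e0 e1 e2
  · have h1 := hsign _ e1
    have h2 := hsign _ e2
    have h0 := sign_three_mul ε 0 h.1
    simp only [zero_add, h1, h2] at h0
    convert! Rel.refl _ _ using 1
    ext i; fin_cases i <;> simp [signedPerm, s0, s1, s2, h0, h1, h2]
  · exact absurd e0 (hc0 _)
  · exact absurd e0 (hc0 _)
  · have h1 := hsign _ e1
    have h2 := hsign _ e2
    have h0 := sign_three_mul ε 0 h.1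
    simp only [zero_add, h1, h2] at h0
    convert! hsw using 1
    ext i; fin_cases i <;> simp [signedPerm, s0, s1, s2, h0, h1, h2]
  · exact absurd e0 (hc0 _)
  · exact absurd e0 (hc0 _)

end Points

end Markoff

namespace Markoff

/-! ### Parameters (c, 0, 0) -/

section NoLinearTerms

variable {p m K : ℕ} [Fact p.Prime] {R : Finset (ZMod p)}

theorem four_ne_zero_zmod (h2 : (2 : ZMod p) ≠ 0) : (4 : ZMod p) ≠ 0 := by
  have := mul_ne_zero h2 h2
  norm_num at this
  exact this

theorem exists_quadraticChar_two (hp : p = 2 * m + 1) (hm : m ≠ 0) (hK : 32 * K + 200 ≤ p)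
    (hR : R.card ≤ K) {s t : ℤ} (hs : s = 1 ∨ s = -1) (ht : t = 1 ∨ t = -1) :
    ∃ x ∉ R, quadraticChar (ZMod p) (x + 2) = s ∧ quadraticChar (ZMod p) (x - 2) = t := by
  have h2 := two_ne_zero_zmod hp hm
  have h4 := four_ne_zero_zmod h2
  obtain ⟨x, hx, h, h', -⟩ := exists_quadraticChar_eq hK R hR (a := -2) (b := 2) (c := 0)
    (fun h => h4 (by linear_combination -h)) (by simpa using h2) h2 hs ht (u := 1) (.inl rfl)
  exact ⟨x, hx, by simpa using h, h'⟩

theorem exists_isOddType (hp : p = 2 * m + 1) (hm : m ≠ 0) (hK : 32 * K + 200 ≤ p)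
    (hR : R.card ≤ K) : ∃ x ∉ R, IsOddType x :=
  exists_quadraticChar_two hp hm hK hR (.inl rfl) (neg_quadraticChar_sign (by simp))

-- The two roots of the quadratic are avoided so that the zero ρ of the discriminant in y² is not 0
-- in `exists_slice_point`. Avoiding two elements accounts for 264 = 32 · 2 + 200.
open Polynomial in
theorem exists_quadraticChar_two_of_quadratic_ne_zero (hp : p = 2 * m + 1) (hm : m ≠ 0)
    (hK : 264 ≤ p) (c d : ZMod p) {s t : ℤ} (hs : s = 1 ∨ s = -1) (ht : t = 1 ∨ t = -1) :
    ∃ x, x ^ 2 - c * x - d ≠ 0 ∧ quadraticChar (ZMod p) (x + 2) = s ∧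
      quadraticChar (ZMod p) (x - 2) = t := by
  classical
  have hmon : (X ^ 2 - (C c * X + C d) : (ZMod p)[X]).Monic :=
    monic_X_pow_sub (lt_of_le_of_lt degree_linear_le (by norm_num))
  have hdeg : (X ^ 2 - (C c * X + C d) : (ZMod p)[X]).natDegree ≤ 2 := by compute_degree
  obtain ⟨x, hx, h⟩ := exists_quadraticChar_two (K := 2)
    (R := (X ^ 2 - (C c * X + C d) : (ZMod p)[X]).roots.toFinset) hp hm (by omega)
    ((Multiset.toFinset_card_le _).trans ((card_roots' _).trans hdeg)) hs ht
  refine ⟨x, fun h0 => hx ?_, h⟩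
  rw [Multiset.mem_toFinset, mem_roots hmon.ne_zero]
  simp only [IsRoot.def, eval_sub, eval_add, eval_mul, eval_pow, eval_X, eval_C]
  linear_combination h0

/-- Prescribed quadratic characters at two linear forms in the square of `y`. -/
theorem exists_quadraticChar_sq (hK : 32 * K + 200 ≤ p)
    (hR : R.card ≤ K) {a b : ZMod p} (ha : a ≠ 0) (hb : b ≠ 0) (hab : a ≠ b) {s t : ℤ}
    (hs : s = 1 ∨ s = -1) (ht : t = 1 ∨ t = -1) :
    ∃ y ∉ R, quadraticChar (ZMod p) (y ^ 2 - a) = s ∧ quadraticChar (ZMod p) (y ^ 2 - b) = t := by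
  classical
  -- The third condition, at 0, is spent on making Y a square.
  obtain ⟨Y, hYR, hY, h, h'⟩ := exists_quadraticChar_eq hK (R.image (· ^ 2))
    (Finset.card_image_le.trans hR) (a := 0) (b := a) (c := b) ha.symm hb.symm hab
    (s := 1) (.inl rfl) hs ht
  rw [sub_zero] at hY
  obtain ⟨y, rfl⟩ := isSquare_of_quadraticChar hY
  refine ⟨y, fun hy => hYR (Finset.mem_image.2 ⟨y, hy, pow_two y⟩), ?_, ?_⟩
  · rwa [pow_two]
  · rwa [pow_two]

/-- Without linear terms in y and z the discriminant is (x² - 4)(y² - ρ), so one character condition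
on y² - ρ makes it a square. -/
theorem exists_slice_point (hp : p = 2 * m + 1) (hm : m ≠ 0) (hK : 32 * K + 200 ≤ p)
    (hR : R.card ≤ K) {c d : ZMod p}
    (hE : ∀ v ∈ smallOrbits ⟨![c, 0, 0], d⟩, ∀ i, v i ∈ R) {x : ZMod p}
    (hx : x ^ 2 - c * x - d ≠ 0) (h4 : quadraticChar (ZMod p) (x + 2) ≠ 0)
    (h4' : quadraticChar (ZMod p) (x - 2) ≠ 0) :
    ∃ y z, ![x, y, z] ∈ surfaceStar ⟨![c, 0, 0], d⟩ := by
  have h2 := two_ne_zero_zmod hp hm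
  have hx4 : x ^ 2 - 4 ≠ 0 := by
    intro h
    have : quadraticChar (ZMod p) (x + 2) * quadraticChar (ZMod p) (x - 2) = 0 := by
      rw [← map_mul, show (x + 2) * (x - 2) = x ^ 2 - 4 by ring, h, quadraticChar_zero]
    exact mul_ne_zero h4 h4' this
  set ρ := 4 * (x ^ 2 - c * x - d) / (x ^ 2 - 4) with hρ
  have hρ' : (x ^ 2 - 4) * ρ = 4 * (x ^ 2 - c * x - d) := mul_div_cancel₀ _ hx4
  have hρ0 : ρ ≠ 0 := by
    intro h; rw [h, mul_zero] at hρ'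
    exact mul_ne_zero (four_ne_zero_zmod h2) hx hρ'.symm
  obtain ⟨y, hyR, hy, -⟩ := exists_quadraticChar_sq hK hR hρ0 (neg_ne_zero.2 hρ0)
    (fun h => mul_ne_zero h2 hρ0 (by linear_combination h)) (quadraticChar_sign hx4)
    (t := 1) (.inl rfl)
  obtain ⟨z, hz⟩ := exists_mem_surfaceStar (x := x) h2 hE hyR
    (isSquare_of_quadraticChar (a := (x ^ 2 - 4) * (y ^ 2 - ρ))
      (by rw [map_mul, hy, quadraticChar_mul_self hx4]))
    (by linear_combination hρ')
  exact ⟨y, z, hz⟩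

theorem exists_rel_neg (hp : p = 2 * m + 1) (hm : m ≠ 0) (hK : 32 * K + 264 ≤ p)
    (hR : R.card ≤ K) {c d : ZMod p}
    (hE : ∀ v ∈ smallOrbits ⟨![c, 0, 0], d⟩, ∀ i, v i ∈ R) :
    ∃ v ∈ surfaceStar ⟨![c, 0, 0], d⟩,
      Rel ⟨![c, 0, 0], d⟩ v (signedPerm 1 ![1, -1, -1] v) := by
  have hn := neg_quadraticChar_sign (p := p) (a := -1) (by simp)
  obtain ⟨x, hx, h1, h1'⟩ := exists_quadraticChar_two_of_quadratic_ne_zero hp hm (by omega)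
    c d (s := -1) (.inr rfl) hn
  obtain ⟨y, z, hv⟩ := exists_slice_point hp hm (by omega) hR hE hx (by rw [h1]; norm_num)
    (by rw [h1']; rcases hn with h | h <;> rw [h] <;> norm_num)
  exact ⟨_, hv, rel_neg hp hm rfl rfl (by simpa using h1) (by simpa using h1')⟩

/-- The automorphisms are generated by τ_yz and neg_yz. Γ realises τ_yz at a point with x of odd
type and neg_yz at a different point; Γ'-transitivity brings the latter over, as every automorphism
commutes with neg_yz. -/
theorem exists_isStable_of_zero (hp : p = 2 * m + 1) (hm : m ≠ 0) (hK : 32 * K + 264 ≤ p)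
    (hR : R.card ≤ K) {c d : ZMod p} (hc : c ≠ 0)
    (hE : ∀ v ∈ smallOrbits ⟨![c, 0, 0], d⟩, ∀ i, v i ∈ R)
    (hfull : ∀ u ∈ surfaceStar ⟨![c, 0, 0], d⟩, ∀ v ∈ surfaceStar ⟨![c, 0, 0], d⟩,
      RelFull ⟨![c, 0, 0], d⟩ u v) :
    ∃ v ∈ surfaceStar ⟨![c, 0, 0], d⟩, IsStable ⟨![c, 0, 0], d⟩ v := by
  have hn := neg_quadraticChar_sign (p := p) (a := -1) (by simp)
  have h2 := two_ne_zero_zmod hp hm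
  set P : Params (ZMod p) := ⟨![c, 0, 0], d⟩ with hP
  have haut : ∀ σ ε, IsAut P σ ε →
      (ε = ![1, 1, 1] ∨ ε = ![1, -1, -1]) ∧ (σ = 1 ∨ σ = Equiv.swap 1 2) := by
    intro σ ε h
    have e0 := h.coef_eq 0
    have hσ0 : σ 0 = 0 := by
      by_contra hne
      have : P.coef (σ 0) = 0 := by
        rcases perm_three_cases σ with ⟨s0, -⟩ | ⟨s0, -⟩ | ⟨s0, -⟩ | ⟨s0, -⟩ | ⟨s0, -⟩ | ⟨s0, -⟩ <;>
          first | exact absurd s0 hne | simp [hP, s0]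
      rw [this, mul_zero] at e0
      exact hc (by simpa [hP] using e0.symm)
    constructor
    · rw [hσ0] at e0
      rcases sign_three_cases ε h.1 with rfl | rfl | rfl | rfl
      · exact .inl rfl
      · exact .inr rfl
      all_goals
        exfalso
        simp [hP] at e0
        exact mul_ne_zero h2 hc (by linear_combination -e0)
    · exact perm_three_fix_zero σ hσ0
  obtain ⟨v₀, hv₀, hneg₀⟩ := exists_rel_neg hp hm hK hR hE
  obtain ⟨x, hx, h1, h1'⟩ := exists_quadraticChar_two_of_quadratic_ne_zero hp hm (by omega)
    c d (s := 1) (.inl rfl) hn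
  obtain ⟨y, z, hv⟩ := exists_slice_point hp hm (by omega) hR hE hx (by rw [h1]; norm_num)
    (by rw [h1']; rcases hn with h | h <;> rw [h] <;> norm_num)
  set v := ![x, y, z] with hvdef
  have hswap : Rel P v (signedPerm (Equiv.swap 1 2) ![1, 1, 1] v) := by
    have := rel_swap_of_isOddType (P := P) (v := v) hp hm rfl ⟨h1, h1'⟩
    simpa [signedPerm_swap_apply] using this
  have hneg : Rel P v (signedPerm 1 ![1, -1, -1] v) := by
    obtain ⟨σ, ε, hσ, hrel⟩ := hfull v₀ hv₀ v hv
    have hη : (![1, -1, -1] : Fin 3 → ℤˣ) ∘ σ = ![1, -1, -1] := by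
      rcases (haut σ ε hσ).2 with rfl | rfl <;> decide
    have := hneg₀.conj hσ hrel (by rw [hη]; exact isAut_diag (-1))
    rwa [hη] at this
  have hone : ∀ w, Rel P w (signedPerm 1 ![1, 1, 1] w) := fun w => by
    rw [signedPerm_one_apply]
    convert! Rel.refl P w using 1
    ext i; fin_cases i <;> simp
  refine ⟨v, hv, fun σ ε h => ?_⟩
  obtain ⟨rfl | rfl, rfl | rfl⟩ := haut σ ε h
  · exact hone v
  · exact hswap
  · exact hneg
  · have := hswap.mul (isAut_diag (-1)) hneg
    convert! this using 2
    decide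

end NoLinearTerms

end Markoff

namespace Markoff

/-! ### Parameters (0, 0, 0) -/

section AllZero

variable {p m K : ℕ} [Fact p.Prime] {R : Finset (ZMod p)}

theorem rel_of_conj {R : Type*} [CommRing R] {P : Params R} {σ τ ρ : Equiv.Perm (Fin 3)}
    {ε η : Fin 3 → ℤˣ} {v : Fin 3 → R} (hτ : IsAut P τ 1) (hττ : τ * τ = 1)
    (hρ : τ * σ * τ = ρ) (hη : ε ∘ τ = η)
    (h : Rel P (signedPerm τ 1 v) (signedPerm σ ε (signedPerm τ 1 v))) :
    Rel P v (signedPerm ρ η v) := by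
  have h1 := h.aut hτ
  simp only [signedPerm_signedPerm, hττ, hρ] at h1
  convert! h1 using 1
  · simp
  · rw [← hη]
    congr 1
    ext i; simp

theorem isAut_zero {d : ZMod p} (σ : Equiv.Perm (Fin 3)) {ε : Fin 3 → ℤˣ} (hε : ∏ i, ε i = 1) :
    IsAut (⟨![0, 0, 0], d⟩ : Params (ZMod p)) σ ε := by
  have : ∀ i : Fin 3, (![0, 0, 0] : Fin 3 → ZMod p) i = 0 := by intro i; fin_cases i <;> rfl
  exact isAut_of_coef_eq hε fun i => by simp only [this, mul_zero]

/-- The discriminant is (x² - 4)(y² - 4) + 4(d - 4). For d = 4 both factors have the same character;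
otherwise it is (x² - 4)(y² - ρ) with ρ different from 0 and 4. Prescribing χ(y² - 4) leaves χ(y +
2) free, so y yields a swap of x and z only up to sign. -/
theorem exists_isOddType_pair (hp : p = 2 * m + 1) (hm : m ≠ 0) (hK : 32 * K + 264 ≤ p)
    (hR : R.card ≤ K) {d : ZMod p} (hE : ∀ v ∈ smallOrbits ⟨![0, 0, 0], d⟩, ∀ i, v i ∈ R) :
    ∃ v ∈ surfaceStar ⟨![0, 0, 0], d⟩, IsOddType (v 0) ∧
      quadraticChar (ZMod p) (v 1 ^ 2 - 4) = -quadraticChar (ZMod p) (-1) := by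
  have hn := neg_quadraticChar_sign (p := p) (a := -1) (by simp)
  have h2 := two_ne_zero_zmod hp hm
  have h4 := four_ne_zero_zmod h2
  obtain ⟨x, hx, h1, h1'⟩ := exists_quadraticChar_two_of_quadratic_ne_zero hp hm (by omega)
    0 d (s := 1) (.inl rfl) hn
  have hχ : quadraticChar (ZMod p) (x ^ 2 - 4) = -quadraticChar (ZMod p) (-1) := by
    rw [show x ^ 2 - 4 = (x + 2) * (x - 2) by ring, map_mul, h1, h1', one_mul]
  have hx4 : x ^ 2 - 4 ≠ 0 := by
    intro h
    rw [h, quadraticChar_zero] at hχ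
    rcases hn with h | h <;> rw [h] at hχ <;> norm_num at hχ
  have key : ∃ y ∉ R, quadraticChar (ZMod p) (y ^ 2 - 4) = -quadraticChar (ZMod p) (-1) ∧
      IsSquare ((x ^ 2 - 4) * (y ^ 2 - 4) + 4 * (d - 4)) := by
    by_cases hd : d = 4
    · obtain ⟨y, hyR, hy, -⟩ := exists_quadraticChar_sq (by omega) hR h4 (neg_ne_zero.2 h4)
        (fun h => mul_ne_zero h2 h4 (by linear_combination h)) hn (t := 1) (.inl rfl)
      refine ⟨y, hyR, hy, isSquare_of_quadraticChar ?_⟩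
      rw [hd, sub_self, mul_zero, add_zero, map_mul, hy, hχ, neg_mul_neg,
        quadraticChar_mul_self (by simp)]
    · set ρ := 4 - 4 * (d - 4) / (x ^ 2 - 4) with hρ
      have hρ' : (x ^ 2 - 4) * (ρ - 4) = -(4 * (d - 4)) := by
        rw [hρ]; field_simp; ring
      have hρ0 : ρ ≠ 0 := by
        intro h
        rw [h] at hρ'
        exact mul_ne_zero h4 hx (by linear_combination -hρ')
      have hρ4 : 4 ≠ ρ := by
        intro h
        rw [← h] at hρ'
        exact mul_ne_zero h4 (sub_ne_zero.2 hd) (by linear_combination hρ')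
      obtain ⟨y, hyR, hy, hy'⟩ := exists_quadraticChar_sq (by omega) hR h4 hρ0 hρ4 hn
        (quadraticChar_sign hx4)
      refine ⟨y, hyR, hy, isSquare_of_quadraticChar ?_⟩
      rw [show (x ^ 2 - 4) * (y ^ 2 - 4) + 4 * (d - 4) = (x ^ 2 - 4) * (y ^ 2 - ρ) by
        linear_combination hρ', map_mul, hy', quadraticChar_mul_self hx4]
  obtain ⟨y, hyR, hy, hsq⟩ := key
  obtain ⟨z, hz⟩ := exists_mem_surfaceStar h2 hE hyR hsq (x := x) (by ring)
  exact ⟨_, hz, ⟨by simpa using h1, by simpa using h1'⟩, by simpa using hy⟩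

theorem prod_signs_outer (e : ℤˣ) : ∏ i, (![e, 1, e] : Fin 3 → ℤˣ) i = 1 := by
  revert e; decide

theorem signs_conj_outer (e : ℤˣ) (ε : Fin 3 → ℤˣ) :
    ![e, 1, e] * (ε * ![e, 1, e] ∘ (1 : Equiv.Perm (Fin 3))) ∘ Equiv.swap 0 2 =
      ε ∘ Equiv.swap 0 2 := by
  revert e ε; decide

/-- Conjugation by the two swaps permutes the three nontrivial even sign changes transitively, and
the sign `e` cancels under conjugation. So one realised sign change gives all. -/
theorem rel_diag_of_swaps {S : Type*} [CommRing S] {P : Params S}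
    (hP : ∀ σ ε, ∏ i, ε i = 1 → IsAut P σ ε) {v : Fin 3 → S} {e : ℤˣ} {η : Fin 3 → ℤˣ} (hη : ∏ i, η i = 1) (hη1 : η ≠ 1)
    (h : Rel P v (signedPerm 1 η v)) (h12 : Rel P v (signedPerm (Equiv.swap 1 2) 1 v))
    (h02 : Rel P v (signedPerm (Equiv.swap 0 2) ![e, 1, e] v)) {ε : Fin 3 → ℤˣ}
    (hε : ∏ i, ε i = 1) : Rel P v (signedPerm 1 ε v) := by
  have he := prod_signs_outer e
  have c12 : ∀ {ε : Fin 3 → ℤˣ}, ∏ i, ε i = 1 → Rel P v (signedPerm 1 ε v) →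
      Rel P v (signedPerm 1 (ε ∘ Equiv.swap 1 2) v) := by
    intro ε hε h
    have := (h12.mul (hP 1 ε hε) h).mul (hP (Equiv.swap 1 2) 1 (by simp)) h12
    convert! this using 2
    · decide
    · ext i; simp
  have c02 : ∀ {ε : Fin 3 → ℤˣ}, ∏ i, ε i = 1 → Rel P v (signedPerm 1 ε v) →
      Rel P v (signedPerm 1 (ε ∘ Equiv.swap 0 2) v) := by
    intro ε hε h
    have := (h02.mul (hP 1 ε hε) h).mul (hP (Equiv.swap 0 2) _ he) h02
    convert! this using 2
    · decide
    · exact (signs_conj_outer e ε).symm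
  have p1 : ∏ i, (![1, -1, -1] : Fin 3 → ℤˣ) i = 1 := by decide
  have p2 : ∏ i, (![-1, 1, -1] : Fin 3 → ℤˣ) i = 1 := by decide
  have p3 : ∏ i, (![-1, -1, 1] : Fin 3 → ℤˣ) i = 1 := by decide
  have t1 : (![1, -1, -1] : Fin 3 → ℤˣ) ∘ Equiv.swap 0 2 = ![-1, -1, 1] := by decide
  have t2 : (![-1, -1, 1] : Fin 3 → ℤˣ) ∘ Equiv.swap 0 2 = ![1, -1, -1] := by decide
  have t3 : (![-1, -1, 1] : Fin 3 → ℤˣ) ∘ Equiv.swap 1 2 = ![-1, 1, -1] := by decide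
  have t4 : (![-1, 1, -1] : Fin 3 → ℤˣ) ∘ Equiv.swap 1 2 = ![-1, -1, 1] := by decide
  have r3 : Rel P v (signedPerm 1 ![-1, -1, 1] v) := by
    rcases sign_three_cases η hη with rfl | rfl | rfl | rfl
    · exact absurd (by decide) hη1
    · exact t1 ▸ c02 p1 h
    · exact t4 ▸ c12 p2 h
    · exact h
  rcases sign_three_cases ε hε with rfl | rfl | rfl | rfl
  · convert! Rel.refl P v using 1
    rw [show (![1, 1, 1] : Fin 3 → ℤˣ) = 1 by decide, signedPerm_one_one]
  · exact t2 ▸ c02 p3 r3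
  · exact t3 ▸ c12 p3 r3
  · exact r3

/-- The point from `exists_isOddType_pair` realises one swap exactly and one up to sign. A sign
change imported by Γ'-transitivity yields all of them, which also removes the unwanted sign; swaps
and sign changes generate all automorphisms. -/
theorem exists_isStable_of_all_zero (hp : p = 2 * m + 1) (hm : m ≠ 0) (hK : 32 * K + 264 ≤ p)
    (hR : R.card ≤ K) {d : ZMod p}
    (hE : ∀ v ∈ smallOrbits ⟨![0, 0, 0], d⟩, ∀ i, v i ∈ R)
    (hfull : ∀ u ∈ surfaceStar ⟨![0, 0, 0], d⟩, ∀ v ∈ surfaceStar ⟨![0, 0, 0], d⟩,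
      RelFull ⟨![0, 0, 0], d⟩ u v) :
    ∃ v ∈ surfaceStar ⟨![0, 0, 0], d⟩, IsStable ⟨![0, 0, 0], d⟩ v := by
  obtain ⟨v₀, hv₀, hneg₀⟩ := exists_rel_neg hp hm hK hR hE
  obtain ⟨v, hv, hx, hy⟩ := exists_isOddType_pair hp hm hK hR hE
  set P : Params (ZMod p) := ⟨![0, 0, 0], d⟩ with hP
  have haut : ∀ σ ε, ∏ i, ε i = 1 → IsAut P σ ε := fun σ ε hε => isAut_zero σ hε
  have h12 : Rel P v (signedPerm (Equiv.swap 1 2) 1 v) := by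
    have := rel_swap_of_isOddType (P := P) hp hm rfl hx
    convert! this using 1
    rw [show (1 : Fin 3 → ℤˣ) = ![1, 1, 1] by decide, signedPerm_swap_apply]
    simp
  obtain ⟨e, he, he'⟩ : ∃ e : ℤˣ, quadraticChar (ZMod p) (v 1 + 2) = e ∧
      quadraticChar (ZMod p) (v 1 - 2) = -quadraticChar (ZMod p) (-1) * e := by
    rw [show v 1 ^ 2 - 4 = (v 1 + 2) * (v 1 - 2) by ring, map_mul] at hy
    have hne : v 1 + 2 ≠ 0 := by
      intro h
      rw [h, quadraticChar_zero, zero_mul] at hy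
      rcases neg_quadraticChar_sign (p := p) (a := -1) (by simp) with h | h <;>
        rw [h] at hy <;> norm_num at hy
    rcases quadraticChar_sign hne with h | h
    · exact ⟨1, by simpa using h, by rw [h] at hy; simpa using hy⟩
    · exact ⟨-1, by simpa using h, by rw [h] at hy; push_cast; linarith⟩
  have h02 : Rel P v (signedPerm (Equiv.swap 0 2) ![e, 1, e] v) := by
    refine rel_of_conj (σ := Equiv.swap 1 2) (τ := Equiv.swap 0 1) (ε := ![1, e, e])
      (haut _ _ (by simp)) (by decide) (by decide) (by clear * -; revert e; decide) ?_
    exact rel_signed_swap hp hm rfl rfl (by simpa [signedPerm] using he)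
      (by simpa [signedPerm] using he')
  obtain ⟨σ, ε, hσ, hrel⟩ := hfull v₀ hv₀ v hv
  have hη : ∏ i, ((![1, -1, -1] : Fin 3 → ℤˣ) ∘ σ) i = 1 := by
    clear * -; revert σ; decide
  have hneg := hneg₀.conj hσ hrel (haut _ _ hη)
  have hdiag : ∀ ε : Fin 3 → ℤˣ, ∏ i, ε i = 1 → Rel P v (signedPerm 1 ε v) := fun ε hε =>
    rel_diag_of_swaps haut hη (by clear * -; revert σ; decide) hneg h12 h02 hε
  have he1 := prod_signs_outer e
  have h02' : Rel P v (signedPerm (Equiv.swap 0 2) 1 v) := by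
    have := h02.mul (haut 1 _ he1) (hdiag _ he1)
    convert! this using 2
    clear * -; revert e; decide
  refine ⟨v, hv, fun τ η h => ?_⟩
  have := (rel_perm_of_swaps (fun σ => haut σ 1 (by simp)) h12 h02' τ).mul (haut 1 η h.1)
    (hdiag η h.1)
  convert! this using 2
  ext i; simp

end AllZero

end Markoff

namespace Markoff

/-! ### Parameters (a, a, a) with a ≠ 0 -/

section AllEqual

variable {p m K : ℕ} [Fact p.Prime] {R : Finset (ZMod p)} {a d : ZMod p} {v : Fin 3 → ZMod p}

theorem isAut_all_eq (σ : Equiv.Perm (Fin 3)) :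
    IsAut (⟨![a, a, a], d⟩ : Params (ZMod p)) σ 1 := by
  have : ∀ i : Fin 3, (![a, a, a] : Fin 3 → ZMod p) i = a := by intro i; fin_cases i <;> rfl
  exact isAut_of_coef_eq (by simp) fun i => by simp [this]

theorem isStable_of_swaps (h2 : (2 : ZMod p) ≠ 0) (ha : a ≠ 0)
    (h12 : Rel ⟨![a, a, a], d⟩ v (signedPerm (Equiv.swap 1 2) 1 v))
    (h02 : Rel ⟨![a, a, a], d⟩ v (signedPerm (Equiv.swap 0 2) 1 v)) :
    IsStable ⟨![a, a, a], d⟩ v := by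
  intro σ ε h
  have hcoef : ∀ i : Fin 3, (![a, a, a] : Fin 3 → ZMod p) i = a := by
    intro i; fin_cases i <;> rfl
  have hε : ε = 1 := by
    funext i
    have h1 : ((ε i : ℤ) : ZMod p) * a = a := by simpa only [hcoef] using h.coef_eq i
    rcases Int.units_eq_one_or (ε i) with hi | hi
    · exact hi
    · exfalso
      rw [hi] at h1
      push_cast at h1
      exact mul_ne_zero h2 ha (by linear_combination -h1)
  rw [hε]
  exact rel_perm_of_swaps isAut_all_eq h12 h02 σ

theorem rel_swap12 (hp : p = 2 * m + 1) (hm : m ≠ 0) (hv : IsOddType (v 0) ∨ v 0 = 2) :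
    Rel ⟨![a, a, a], d⟩ v (signedPerm (Equiv.swap 1 2) 1 v) := by
  have h : Rel ⟨![a, a, a], d⟩ v ![v 0, v 2, v 1] := by
    rcases hv with h | h
    · exact rel_swap_of_isOddType hp hm rfl h
    · exact rel_swap_of_eq_two hp hm rfl h
  convert! h using 1
  rw [show (1 : Fin 3 → ℤˣ) = ![1, 1, 1] by decide, signedPerm_swap_apply]
  simp

theorem rel_swap02 (hp : p = 2 * m + 1) (hm : m ≠ 0) (hv : IsOddType (v 1) ∨ v 1 = 2) :
    Rel ⟨![a, a, a], d⟩ v (signedPerm (Equiv.swap 0 2) 1 v) :=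
  rel_of_conj (σ := Equiv.swap 1 2) (τ := Equiv.swap 0 1) (ε := 1) (isAut_all_eq _) (by decide)
    (by decide) (by decide) (rel_swap12 hp hm (by simpa [signedPerm] using hv))

theorem rel_swap01 (hp : p = 2 * m + 1) (hm : m ≠ 0) (hv : IsOddType (v 2) ∨ v 2 = 2) :
    Rel ⟨![a, a, a], d⟩ v (signedPerm (Equiv.swap 0 1) 1 v) :=
  rel_of_conj (σ := Equiv.swap 1 2) (τ := Equiv.swap 0 2) (ε := 1) (isAut_all_eq _) (by decide)
    (by decide) (by decide) (rel_swap12 hp hm (by simpa [signedPerm] using hv))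

theorem exists_isStable_of_point (hp : p = 2 * m + 1) (hm : m ≠ 0) (ha : a ≠ 0)
    (hE : ∀ v ∈ smallOrbits ⟨![a, a, a], d⟩, ∀ i, v i ∈ R) {x y s : ZMod p} (hyR : y ∉ R)
    (hx : IsOddType x ∨ x = 2) (hy : IsOddType y) (hs : quadraticChar (ZMod p) s = 1)
    (h : (x * y + a) ^ 2 - 4 * (x ^ 2 + y ^ 2 - a * x - a * y - d) = s) :
    ∃ v ∈ surfaceStar ⟨![a, a, a], d⟩, IsStable ⟨![a, a, a], d⟩ v := by
  have h2 := two_ne_zero_zmod hp hm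
  obtain ⟨z, hz⟩ := exists_mem_surfaceStar h2 hE hyR (isSquare_of_quadraticChar hs) h
  exact ⟨_, hz, isStable_of_swaps h2 ha (rel_swap12 hp hm (by simpa using hx))
    (rel_swap02 hp hm (by simpa using .inl hy))⟩

/-- On y = -2 the equation depends only on x + z, so the slice is a pair of lines. V₁ and V₃
interchange them, and their composite translates x by -s, which is transitive over the prime field.
-/
theorem rel_line {t s : ZMod p} (hs : s ≠ 0) (ht : 2 * t = a + s) (x x' : ZMod p) :
    Rel ⟨![a, a, a], d⟩ ![x, -2, t - x] ![x', -2, t - x'] := by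
  have step : ∀ x, Rel ⟨![a, a, a], d⟩ ![x, -2, t - x] ![x - s, -2, t - (x - s)] := by
    intro x
    have h1 := Rel.V1 ⟨![a, a, a], d⟩ ![x, -2, t - x]
    have h2 := h1.trans (Rel.V3 ⟨![a, a, a], d⟩ _)
    convert! h2 using 1
    ext i
    fin_cases i <;> simp [V1_apply, V3_apply]
    · linear_combination ht
    · linear_combination -ht
  have iter : ∀ n : ℕ, Rel ⟨![a, a, a], d⟩ ![x, -2, t - x] ![x - n * s, -2, t - (x - n * s)] := by
    intro n
    induction n with
    | zero => simpa using Rel.refl _ _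
    | succ n ih =>
      have := ih.trans (step _)
      rw [show x - n * s - s = x - (n + 1 : ℕ) * s by push_cast; ring] at this
      exact this
  have := iter ((x - x') / s).val
  rwa [ZMod.natCast_zmod_val, div_mul_cancel₀ _ hs, sub_sub_cancel] at this

/-- The line lies in one Γ-orbit. Its point with x = 2 realises τ_yz, the one with z = 2 realises
τ_xy, and both carry over to a point of the line off the small orbits. -/
theorem exists_isStable_of_line (hp : p = 2 * m + 1) (hm : m ≠ 0) (hK : 32 * K + 264 ≤ p)
    (hR : R.card ≤ K) (ha : a ≠ 0) (hE : ∀ v ∈ smallOrbits ⟨![a, a, a], d⟩, ∀ i, v i ∈ R)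
    {s : ZMod p} (hs0 : s ≠ 0) (hs : a ^ 2 - 16 - 8 * a + 4 * d = s ^ 2) :
    ∃ v ∈ surfaceStar ⟨![a, a, a], d⟩, IsStable ⟨![a, a, a], d⟩ v := by
  have h2 := two_ne_zero_zmod hp hm
  set P : Params (ZMod p) := ⟨![a, a, a], d⟩ with hP
  obtain ⟨x, hxR, -⟩ := exists_isOddType hp hm (by omega) hR
  set t := (a + s) / 2 with ht
  have ht' : 2 * t = a + s := mul_div_cancel₀ _ h2
  have hv : ![x, -2, t - x] ∈ surface P := by
    simp only [surface, Set.mem_ofPred_eq, hP, Matrix.cons_val_zero, Matrix.cons_val_one,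
      Matrix.cons_val, Params.A_mk, Params.B_mk, Params.C_mk]
    apply mul_left_cancel₀ (four_ne_zero_zmod h2)
    linear_combination (2 * t + s - a) * ht' - hs
  have hline := rel_line (d := d) hs0 ht'
  have transfer : ∀ (x' : ZMod p) (σ : Equiv.Perm (Fin 3)),
      Rel P ![x', -2, t - x'] (signedPerm σ 1 ![x', -2, t - x']) →
      Rel P ![x, -2, t - x] (signedPerm σ 1 ![x, -2, t - x]) := fun x' σ h =>
    ((hline x x').trans h).trans ((hline x' x).aut (isAut_all_eq σ))
  have h12 := transfer 2 (Equiv.swap 1 2) (rel_swap12 hp hm (by simp))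
  have h01 := transfer (t - 2) (Equiv.swap 0 1) (rel_swap01 hp hm (by simp))
  have h02 : Rel P ![x, -2, t - x] (signedPerm (Equiv.swap 0 2) 1 ![x, -2, t - x]) := by
    have := (h12.mul (isAut_all_eq _) h01).mul (isAut_all_eq _) h12
    convert! this using 2
    · decide
  exact ⟨_, ⟨hv, fun hsm => hxR (by simpa using hE _ hsm 0)⟩, isStable_of_swaps h2 ha h12 h02⟩

/-- Take x = 2 and y of odd type, so that τ_yz and τ_xz are both realised; the discriminant 8a(y -
ρ) must be a square. Generically this prescribes characters at the distinct points -2, 2, ρ; the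
coincidences ρ = ±2 need other choices. -/
theorem exists_isStable_of_all_eq (hp : p = 2 * m + 1) (hm : m ≠ 0) (hK : 32 * K + 264 ≤ p)
    (hR : R.card ≤ K) (ha : a ≠ 0) (hE : ∀ v ∈ smallOrbits ⟨![a, a, a], d⟩, ∀ i, v i ∈ R) :
    ∃ v ∈ surfaceStar ⟨![a, a, a], d⟩, IsStable ⟨![a, a, a], d⟩ v := by
  have h2 := two_ne_zero_zmod hp hm
  have h4 := four_ne_zero_zmod h2
  have hn := neg_quadraticChar_sign (p := p) (a := -1) (by simp)
  have h8 : 8 * a ≠ 0 := by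
    have := mul_ne_zero (mul_ne_zero h2 h4) ha
    convert! this using 2; norm_num
  set ρ := -(a ^ 2 - 16 + 8 * a + 4 * d) / (8 * a) with hρ
  have hρ' : 8 * a * ρ = -(a ^ 2 - 16 + 8 * a + 4 * d) := mul_div_cancel₀ _ h8
  by_cases hρ2 : ρ = 2
  · rw [hρ2] at hρ'
    by_cases hχ : quadraticChar (ZMod p) (8 * a) = -quadraticChar (ZMod p) (-1)
    · obtain ⟨y, hyR, hy⟩ := exists_isOddType hp hm (by omega) hR
      refine exists_isStable_of_point hp hm ha hE hyR (.inr rfl) hy (s := 8 * a * (y - 2)) ?_ ?_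
      · rw [map_mul, hχ, hy.2, neg_mul_neg, quadraticChar_mul_self (by simp)]
      · linear_combination hρ'
    · have hχ' : quadraticChar (ZMod p) (-1 * (8 * a)) = 1 := by
        rw [map_mul]
        rcases quadraticChar_sign h8 with h | h <;>
          rcases quadraticChar_sign (p := p) (a := -1) (by simp) with h' | h' <;>
          rw [h, h'] at hχ ⊢ <;> simp at hχ ⊢
      obtain ⟨r, hr⟩ := isSquare_of_quadraticChar hχ'
      -- Now -8a = r², and ρ = 2 turns the discriminant of the slice y = -2 into -32a = (2r)².
      refine exists_isStable_of_line hp hm hK hR ha hE (s := 2 * r) ?_ ?_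
      · refine mul_ne_zero h2 ?_
        rintro rfl
        exact h8 (by linear_combination -hr)
      · linear_combination 4 * hr + hρ'
  by_cases hρ2' : ρ = -2
  · rw [hρ2'] at hρ'
    -- For ρ = -2 the discriminant factors as (x + 2)(y + 2)((x - 2)(y - 2) + 2a), with last factor
    -- (x - 2)(y - τ). Excluding x = 2 + a/2 ensures τ ≠ -2.
    obtain ⟨x, hxR, hx⟩ := exists_isOddType (K := 1) (R := {2 + a / 2}) hp hm (by omega) (by simp)
    have hx2 := hx.sub_two_ne_zero
    set τ := 2 - 2 * a / (x - 2) with hτ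
    have hτ' : (x - 2) * (2 - τ) = 2 * a := by rw [hτ]; field_simp; ring
    have hτ2 : τ ≠ 2 := by
      intro h
      rw [h, sub_self, mul_zero] at hτ'
      exact mul_ne_zero h2 ha hτ'.symm
    have hτ2' : -2 ≠ τ := by
      intro h
      rw [← h] at hτ'
      refine hxR (Finset.mem_singleton.2 ?_)
      field_simp
      apply mul_left_cancel₀ h2
      linear_combination hτ'
    obtain ⟨y, hyR, hy, hy', hy''⟩ := exists_quadraticChar_eq (K := K) (by omega) R hR
      (a := -2) (b := 2) (c := τ) (fun h => h4 (by linear_combination -h)) hτ2' hτ2.symm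
      (.inl rfl) hn (quadraticChar_sign hx2)
    rw [sub_neg_eq_add] at hy
    refine exists_isStable_of_point hp hm ha hE hyR (.inl hx) ⟨hy, hy'⟩
      (s := (x + 2) * (y + 2) * ((x - 2) * (y - τ))) ?_ ?_
    · rw [map_mul, map_mul, map_mul, hx.1, hy, hy'', quadraticChar_mul_self hx2]; norm_num
    · linear_combination hρ' - (x + 2) * (y + 2) * hτ'
  · obtain ⟨y, hyR, hy, hy', hy''⟩ := exists_quadraticChar_eq (K := K) (by omega) R hR
      (a := -2) (b := 2) (c := ρ) (fun h => h4 (by linear_combination -h)) (Ne.symm hρ2')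
      (Ne.symm hρ2) (.inl rfl) hn (quadraticChar_sign h8)
    rw [sub_neg_eq_add] at hy
    refine exists_isStable_of_point hp hm ha hE hyR (.inr rfl) ⟨hy, hy'⟩
      (s := 8 * a * (y - ρ)) ?_ ?_
    · rw [map_mul, hy'', quadraticChar_mul_self h8]
    · linear_combination hρ'

end AllEqual

/-! ### Descent from Γ' to Γ -/

section Main

variable {R : Type*} [CommRing R]

/-- If the Vieta involutions and the automorphisms of the parameters together act transitively,
then so do the Vieta involutions alone. -/
def Descends (P : Params R) : Prop :=
  (∀ u ∈ surfaceStar P, ∀ v ∈ surfaceStar P, RelFull P u v) →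
    ∀ u ∈ surfaceStar P, ∀ v ∈ surfaceStar P, Rel P u v

theorem descends_of_exists_isStable {P : Params R}
    (h : (∀ u ∈ surfaceStar P, ∀ v ∈ surfaceStar P, RelFull P u v) →
      ∃ v ∈ surfaceStar P, IsStable P v) : Descends P := by
  intro hfull
  obtain ⟨w, hw, hst⟩ := h hfull
  have key : ∀ u ∈ surfaceStar P, Rel P w u := by
    intro u hu
    obtain ⟨σ, ε, hσ, hrel⟩ := hfull w hw u hu
    exact (hst σ ε hσ).trans hrel
  exact fun u hu v hv => (key u hu).symm.trans (key v hv)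

theorem Descends.of_signedPerm {P : Params R} (σ : Equiv.Perm (Fin 3)) {ε : Fin 3 → ℤˣ}
    (hε : ∏ i, ε i = 1) (h : Descends (P.signedPerm σ ε)) : Descends P := by
  intro hfull u hu v hv
  have hinv := prod_invSigns σ hε
  have hP := Params.signedPerm_inv_signedPerm σ ε P
  have hback : ∀ w ∈ surfaceStar (P.signedPerm σ ε),
      signedPerm σ⁻¹ (invSigns σ ε) w ∈ surfaceStar P := by
    intro w hw
    have := signedPerm_mem_surfaceStar σ⁻¹ hinv hw
    rwa [hP] at this
  have h' := h (fun u' hu' v' hv' => by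
    obtain ⟨τ, η, hτ, hrel⟩ := hfull _ (hback u' hu') _ (hback v' hv')
    have h1 := hrel.signedPerm σ hε
    rw [signedPerm_signedPerm_inv, signedPerm_signedPerm, signedPerm_signedPerm] at h1
    refine ⟨_, _, ⟨prod_signs_comp hinv (prod_signs_comp hτ.1 hε σ) (τ * σ), ?_⟩, h1⟩
    rw [← Params.signedPerm_signedPerm, hP, ← Params.signedPerm_signedPerm, hτ.2])
    _ (signedPerm_mem_surfaceStar σ hε hu) _ (signedPerm_mem_surfaceStar σ hε hv)
  have h2 := h'.signedPerm σ⁻¹ hinv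
  rwa [hP, signedPerm_inv_signedPerm, signedPerm_inv_signedPerm] at h2

theorem Params.eq_mk {S : Type*} (P : Params S) (h : P.B = P.C) : P = ⟨![P.A, P.B, P.B], P.D⟩ := by
  cases P with
  | mk coef D =>
    simp only [Params.A, Params.B, Params.C] at h ⊢
    congr 1
    ext i; fin_cases i <;> simp [h]

/-- Any extra automorphism forces two of A, B, C to agree up to sign. A permutation moves them to
the last two places, and one sign among these can be corrected at the cost of the sign of the first.
-/
theorem exists_signedPerm_of_isExtraAut {P : Params R} {g : Equiv.Perm (Fin 3 → R)}
    (hg : IsExtraAut P g) : ∃ (σ : Equiv.Perm (Fin 3)) (ε : Fin 3 → ℤˣ), ∏ i, ε i = 1 ∧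
      (P.signedPerm σ ε).B = (P.signedPerm σ ε).C := by
  have p3 : ∏ i, (![-1, -1, 1] : Fin 3 → ℤˣ) i = 1 := by decide
  have p3' : ∏ i, (![-1, 1, -1] : Fin 3 → ℤˣ) i = 1 := by decide
  have p1 : ∏ i, (1 : Fin 3 → ℤˣ) i = 1 := by decide
  cases hg with
  | negXY hA hB =>
    exact ⟨Equiv.swap 0 2, 1, p1, by
      simp [Params.signedPerm, signedPerm, Equiv.swap_apply_def, Params.B, Params.C, hA, hB]⟩
  | negXZ hA hC =>
    exact ⟨Equiv.swap 0 1, 1, p1, by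
      simp [Params.signedPerm, signedPerm, Equiv.swap_apply_def, Params.B, Params.C, hA, hC]⟩
  | negYZ hB hC =>
    exact ⟨1, 1, p1, by simp [Params.signedPerm, Params.B, Params.C, hB, hC]⟩
  | tauXY h =>
    exact ⟨Equiv.swap 0 2, 1, p1, by
      simp [Params.signedPerm, signedPerm, Equiv.swap_apply_def, Params.B, Params.C, h]⟩
  | tauXZ h =>
    exact ⟨Equiv.swap 0 1, 1, p1, by
      simp [Params.signedPerm, signedPerm, Equiv.swap_apply_def, Params.B, Params.C, h]⟩
  | tauYZ h =>
    exact ⟨1, 1, p1, by simp [Params.signedPerm, Params.B, Params.C, h]⟩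
  | negTauXY h =>
    exact ⟨Equiv.swap 0 2, ![-1, 1, -1], p3', by
      simp [Params.signedPerm, signedPerm, Equiv.swap_apply_def, Params.B, Params.C, h]⟩
  | negTauXZ h =>
    exact ⟨Equiv.swap 0 1, ![-1, -1, 1], p3, by
      simp [Params.signedPerm, signedPerm, Equiv.swap_apply_def, Params.B, Params.C, h]⟩
  | negTauYZ h =>
    exact ⟨1, ![-1, -1, 1], p3, by
      simp [Params.signedPerm, signedPerm, Params.B, Params.C, h]⟩

theorem descends_of_B_eq_C {p m K : ℕ} [Fact p.Prime] (hp : p = 2 * m + 1) (hm : m ≠ 0)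
    (hK : 32 * K + 264 ≤ p) (hE : ∀ P : Params (ZMod p), ∃ R : Finset (ZMod p), R.card ≤ K ∧
      ∀ v ∈ smallOrbits P, ∀ i, v i ∈ R) (P : Params (ZMod p)) (hBC : P.B = P.C) :
    Descends P := by
  rw [P.eq_mk hBC]
  generalize P.A = c
  generalize P.B = a
  generalize P.D = d
  by_cases ha : a = 0
  · obtain ⟨R, hR, hRE⟩ := hE ⟨![c, a, a], d⟩
    subst ha
    by_cases hc : c = 0
    · subst hc
      exact descends_of_exists_isStable (exists_isStable_of_all_zero hp hm hK hR hRE)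
    · exact descends_of_exists_isStable (exists_isStable_of_zero hp hm hK hR hc hRE)
  have heq : ∀ b : ZMod p, b ≠ 0 → Descends (⟨![b, b, b], d⟩ : Params (ZMod p)) := by
    intro b hb
    obtain ⟨R, hR, hRE⟩ := hE ⟨![b, b, b], d⟩
    exact descends_of_exists_isStable fun _ => exists_isStable_of_all_eq hp hm hK hR hb hRE
  by_cases hc : c = a
  · rw [hc]; exact heq a ha
  by_cases hc' : c = -a
  -- Negating the last two parameters turns (-a, a, a) into (-a, -a, -a).
  · refine Descends.of_signedPerm 1 (ε := ![1, -1, -1]) (by decide) ?_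
    have : (⟨![c, a, a], d⟩ : Params (ZMod p)).signedPerm 1 ![1, -1, -1] =
        ⟨![-a, -a, -a], d⟩ := by
      simp only [Params.signedPerm, signedPerm_one_apply, hc']
      simp
    rw [this]
    exact heq (-a) (neg_ne_zero.2 ha)
  · obtain ⟨R, hR, hRE⟩ := hE ⟨![c, a, a], d⟩
    exact descends_of_exists_isStable fun _ =>
      exists_isStable_of_ne hp hm (by omega) hR ha hc hc' hRE

end Main

end Markoff

theorem mainTheorem4 :
    ∃ N : ℕ, ∀ p : ℕ, p.Prime → N ≤ p → ∀ P : Markoff.Params (ZMod p),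
      Markoff.ActsTransitivelyOn (Markoff.fullGroup P) (Markoff.surfaceStar P) →
        Markoff.ActsTransitivelyOn (Markoff.vietaGroup P) (Markoff.surfaceStar P) := by
  obtain ⟨K, hK⟩ := Markoff.exists_finset_smallOrbits
  -- This covers 32K + 200 for avoiding the small-orbit coordinates and 264 for the auxiliary sets
  -- of at most two elements.
  refine ⟨32 * K + 264, fun p hprime hN P htrans => ?_⟩
  have : Fact p.Prime := ⟨hprime⟩
  have hp2 : p ≠ 2 := by omega
  obtain ⟨m, hm⟩ := hprime.odd_of_ne_two hp2
  by_cases hex : ∃ g, Markoff.IsExtraAut P g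
  · obtain ⟨g, hg⟩ := hex
    obtain ⟨σ, ε, hε, hBC⟩ := Markoff.exists_signedPerm_of_isExtraAut hg
    have hd := Markoff.Descends.of_signedPerm σ hε
      (Markoff.descends_of_B_eq_C hm (by omega) hN (hK p hp2) _ hBC)
    refine hd fun u hu v hv => ?_
    obtain ⟨g, hg, rfl⟩ := htrans u hu v hv
    exact Markoff.relFull_of_mem_fullGroup hg u
  · have hempty : {g | Markoff.IsExtraAut P g} = ∅ :=
      Set.eq_empty_iff_forall_notMem.2 fun g hg => hex ⟨g, hg⟩
    have : Markoff.fullGroup P = Markoff.vietaGroup P := by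
      rw [Markoff.fullGroup, Markoff.vietaGroup, hempty, Set.union_empty]
    rwa [this] at htrans
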